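/- **Corollary 2.9.** Let $\mathcal H$ be a complex Hilbert space and let $\mathfrak C_1^{\rm sa}$ be the real Banach space of all self-adjoint trace-class operators on $\mathcal H$ with the trace norm $\|u\|=\operatorname{Tr}|u|$. Write $u\ge 0$ if $(ux,x)\ge 0$ for all $x\in\mathcal H$. An operator $A\colon D(A)\to\mathfrak C_1^{\rm sa}$ defined on a subspace $D(A)\subset\mathfrak C_1^{\rm sa}$ is called positivity preserving if $Au\ge 0$ for all $u\in D(A)^+:=\{u\in D(A):u\ge 0\}$; for $A,B\colon D\to\mathfrak C_1^{\rm sa}$ write $A\le B$ if $B-A$ is positivity preserving. A semigroup is called positivity preserving if all its members are. Let $-H$ be the generator of a positivity preserving contraction $C_0$-semigroup on $\mathfrak C_1^{\rm sa}$, and let $K\colon D(H)\to\mathfrak C_1^{\rm sa}$ be a positivity preserving linear operator with $$\operatorname{Tr}(Ku)\le\operatorname{Tr}(Hu)\qquad\text{for all }u\in D(H)^+ .$$ A net $(K_\alpha)_{\alpha\in J}$ of linear operators $K_\alpha\colon D(H)\to\mathfrak C_1^{\rm sa}$, indexed by a nonempty directed set $J$, is called a *functional regularisation* of $K$ if 1.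 $K_\alpha$ is positivity preserving for all $\alpha\in J$; 2. for all $\alpha\in J$ there are $a_\alpha\in[0,\infty)$ and $b_\alpha\in[0,1)$ such that $\operatorname{Tr}(K_\alpha u)\le a_\alpha\operatorname{Tr}u+b_\alpha\operatorname{Tr}(Hu)$ for all $u\in D(H)^+$; 3. $K_\alpha\le K_\beta\le K$ for all $\alpha,\beta\in J$ with $\alpha\le\beta$; 4. for all $u\in D(H)^+$ there is a dense subspace $V$ of $\mathcal H$ such that $\lim_\alpha((K_\alpha u)x,x)=((Ku)x,x)$ for all $x\in V$. For a functional regularisation $(K_\alpha)_{\alpha\in J}$ of $K$, the *associated semigroup* is the family $(T_t)_{t>0}$ given by $T_tu=\lim_\alpha T^\alpha_tu$ (limit in trace norm) for all $t>0$ and $u\in\mathfrak C_1^{\rm sa}$, where $(T^\alpha_t)_{t>0}$ is the $C_0$-semigroup generated by $-(H-K_\alpha)$, with domain $D(H-K_\alpha)=D(H)$. Let $(K_\alpha)_{\alpha\in J}$ and $(K'_\alpha)_{\alpha\in J'}$ be two functional regularisations of $K$. Then their associated semigroups $(T_t)_{t>0}$ and $(T'_t)_{t>0}$ exist (that is, all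 the operators $-(H-K_\alpha)$ and $-(H-K'_\alpha)$ generate $C_0$-semigroups and the limits exist) and are positivity preserving contraction $C_0$-semigroups on $\mathfrak C_1^{\rm sa}$, and $$T_t=T'_t\qquad\text{for all }t>0 .$$ -/

import Mathlib

open Filter Topology
open scoped InnerProductSpace

namespace KatoReg

noncomputable section

/-! ### Trace and trace norm of bounded operators on a complex Hilbert space -/

section Trace

variable {E : Type*} [NormedAddCommGroup E] [InnerProductSpace ℂ E] [CompleteSpace E]

/-- The index set of a chosen orthonormal (Hilbert) basis of `E`. -/
def basisIndex (E : Type*) [NormedAddCommGroup E] [InnerProductSpace ℂ E] [CompleteSpace E] :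
    Set E :=
  (exists_hilbertBasis ℂ E).choose

/-- A chosen orthonormal (Hilbert) basis of `E`. -/
def stdBasis (E : Type*) [NormedAddCommGroup E] [InnerProductSpace ℂ E] [CompleteSpace E] :
    HilbertBasis (basisIndex E) ℂ E :=
  (exists_hilbertBasis ℂ E).choose_spec.choose

/-- The trace in `[0, ∞]` of a positive bounded operator `a`: the sum of `⟪e i, a (e i)⟫` over an
orthonormal basis `e` (it does not depend on the basis, see `posTrace_eq_basis`). -/
def posTrace (a : E →L[ℂ] E) : ENNReal :=
  ∑' i, ENNReal.ofReal (⟪stdBasis E i, a (stdBasis E i)⟫_ℂ).re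

/-- The trace norm `Tr |u|`, with values in `[0, ∞]`, where `|u| = (u* u)^(1/2)`. -/
def traceNorm (u : E →L[ℂ] E) : ENNReal :=
  posTrace (CFC.abs u)

/-- A bounded operator is trace class if `Tr |u| < ∞`. -/
def IsTraceClass (u : E →L[ℂ] E) : Prop :=
  traceNorm u < ⊤

lemma parseval {ι : Type*} (c : HilbertBasis ι ℂ E) (x : E) :
    ENNReal.ofReal (‖x‖ ^ 2) = ∑' j, ENNReal.ofReal (‖⟪c j, x⟫_ℂ‖ ^ 2) := by
  have h := c.hasSum_inner_mul_inner x x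
  have h2 : HasSum (fun j => ‖⟪c j, x⟫_ℂ‖ ^ 2) (‖x‖ ^ 2) := by
    have h3 := Complex.hasSum_re h
    have e1 : (⟪x, x⟫_ℂ).re = ‖x‖ ^ 2 := by
      rw [inner_self_eq_norm_sq_to_K]; norm_cast
    rw [e1] at h3
    refine h3.congr_fun ?_ |> fun h => h
    intro j
    rw [← inner_conj_symm x (c j), Complex.conj_mul']
    norm_cast
  rw [← h2.tsum_eq]
  exact ENNReal.ofReal_tsum_of_nonneg (fun j => by positivity) h2.summable

/-- Symmetry of the Hilbert-Schmidt sum under taking adjoints. -/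
lemma hilbertSchmidt_adjoint {ι κ : Type*} (b : HilbertBasis ι ℂ E) (c : HilbertBasis κ ℂ E)
    (T : E →L[ℂ] E) :
    ∑' i, ENNReal.ofReal (‖T (b i)‖ ^ 2) = ∑' j, ENNReal.ofReal (‖star T (c j)‖ ^ 2) := by
  simp_rw [parseval c (T _), parseval b (star T _)]
  rw [ENNReal.tsum_comm]
  refine tsum_congr fun j => tsum_congr fun i => ?_
  rw [ContinuousLinearMap.star_eq_adjoint, ContinuousLinearMap.adjoint_inner_right,
    norm_inner_symm]

lemma inner_eq_norm_sqrt_sq {a : E →L[ℂ] E} (ha : 0 ≤ a) (x : E) :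
    (⟪x, a x⟫_ℂ).re = ‖CFC.sqrt a x‖ ^ 2 := by
  have hs : IsSelfAdjoint (CFC.sqrt a) := (CFC.sqrt_nonneg a).isSelfAdjoint
  conv_lhs => rw [← CFC.sqrt_mul_sqrt_self a ha]
  rw [mul_apply_eq_comp, ← ContinuousLinearMap.adjoint_inner_left,
    ← ContinuousLinearMap.star_eq_adjoint, hs.star_eq, inner_self_eq_norm_sq_to_K]
  norm_cast

/-- The trace of a positive operator can be computed in any orthonormal basis. -/
lemma posTrace_eq_basis {ι : Type*} (b : HilbertBasis ι ℂ E) {a : E →L[ℂ] E} (ha : 0 ≤ a) :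
    posTrace a = ∑' i, ENNReal.ofReal (⟪b i, a (b i)⟫_ℂ).re := by
  have hs : IsSelfAdjoint (CFC.sqrt a) := (CFC.sqrt_nonneg a).isSelfAdjoint
  simp_rw [posTrace, inner_eq_norm_sqrt_sq ha]
  rw [hilbertSchmidt_adjoint (stdBasis E) b, hs.star_eq]

lemma posTrace_zero : posTrace (0 : E →L[ℂ] E) = 0 := by
  simp [posTrace]

lemma re_inner_nonneg {a : E →L[ℂ] E} (ha : 0 ≤ a) (x : E) : 0 ≤ (⟪x, a x⟫_ℂ).re := by
  rw [inner_eq_norm_sqrt_sq ha]; positivity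

lemma posTrace_add {a b : E →L[ℂ] E} (ha : 0 ≤ a) (hb : 0 ≤ b) :
    posTrace (a + b) = posTrace a + posTrace b := by
  simp_rw [posTrace]
  rw [← ENNReal.tsum_add]
  refine tsum_congr fun i => ?_
  rw [← ENNReal.ofReal_add (re_inner_nonneg ha _) (re_inner_nonneg hb _)]
  simp

lemma posTrace_mono {a b : E →L[ℂ] E} (h : a ≤ b) : posTrace a ≤ posTrace b := by
  refine ENNReal.tsum_le_tsum fun i => ENNReal.ofReal_le_ofReal ?_
  have := re_inner_nonneg (sub_nonneg.2 h) (stdBasis E i)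
  simpa [inner_sub_right] using this

lemma posTrace_smul {r : ℝ} (hr : 0 ≤ r) (a : E →L[ℂ] E) :
    posTrace (r • a) = ENNReal.ofReal r * posTrace a := by
  simp_rw [posTrace]
  rw [← ENNReal.tsum_mul_left]
  refine tsum_congr fun i => ?_
  rw [← ENNReal.ofReal_mul hr]
  congr 1
  rw [smul_apply, inner_smul_right_eq_smul]
  simp

lemma posTrace_conj_le {p a : E →L[ℂ] E} (hp : IsStarProjection p) (ha : 0 ≤ a) :
    posTrace (p * a * p) ≤ posTrace a := by
  have hs : IsSelfAdjoint (CFC.sqrt a) := (CFC.sqrt_nonneg a).isSelfAdjoint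
  have key : ∀ x, (⟪x, (p * a * p) x⟫_ℂ).re = ‖(CFC.sqrt a * p) x‖ ^ 2 := by
    intro x
    rw [mul_apply_eq_comp, mul_apply_eq_comp,
      ← ContinuousLinearMap.adjoint_inner_left, ← ContinuousLinearMap.star_eq_adjoint,
      hp.isSelfAdjoint.star_eq, inner_eq_norm_sqrt_sq ha]
    rfl
  have h1 : posTrace (p * a * p)
      = ∑' i, ENNReal.ofReal (‖(CFC.sqrt a * p) (stdBasis E i)‖ ^ 2) := by
    simp_rw [posTrace, key]
  have h2 : posTrace a = ∑' i, ENNReal.ofReal (‖CFC.sqrt a (stdBasis E i)‖ ^ 2) := by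
    simp_rw [posTrace, inner_eq_norm_sqrt_sq ha]
  rw [h1, h2, hilbertSchmidt_adjoint (stdBasis E) (stdBasis E)]
  refine ENNReal.tsum_le_tsum fun i => ENNReal.ofReal_le_ofReal ?_
  rw [star_mul, hs.star_eq, hp.isSelfAdjoint.star_eq, mul_apply_eq_comp]
  have := p.le_of_opNorm_le hp.norm_le (CFC.sqrt a (stdBasis E i))
  rw [one_mul] at this
  gcongr

lemma traceNorm_sub_le {a b : E →L[ℂ] E} (ha : 0 ≤ a) (hb : 0 ≤ b) :
    traceNorm (a - b) ≤ posTrace a + posTrace b := by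
  set w := a - b with hw
  have hwsa : IsSelfAdjoint w := ha.isSelfAdjoint.sub hb.isSelfAdjoint
  have hP : 0 ≤ w⁺ := CFC.posPart_nonneg w
  have hN : 0 ≤ w⁻ := CFC.negPart_nonneg w
  have hdec : w⁺ - w⁻ = w := CFC.posPart_sub_negPart w hwsa
  -- the orthogonal projection onto the kernel of the positive part
  let U : Submodule ℂ E := LinearMap.ker (w⁺ : E →L[ℂ] E).toLinearMap
  have : CompleteSpace U := (w⁺ : E →L[ℂ] E).isClosed_ker.completeSpace_coe
  set q : E →L[ℂ] E := U.starProjection with hq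
  have hqp : IsStarProjection q := isStarProjection_starProjection
  have hpp : IsStarProjection (1 - q) := hqp.one_sub
  have hPq : w⁺ * q = 0 := by
    ext x
    have : q x ∈ U := by simp [hq]
    simpa [U] using this
  have hqP : q * w⁺ = 0 := by
    have := congrArg star hPq
    simpa [hqp.isSelfAdjoint.star_eq, hP.isSelfAdjoint.star_eq] using this
  have hqN : q * w⁻ = w⁻ := by
    ext x
    have hx : w⁻ x ∈ U := by
      have h := congrArg (fun T : E →L[ℂ] E => T x) (CFC.posPart_mul_negPart w)
      exact h
    simpa [hq] using Submodule.starProjection_eq_self_iff.2 hx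
  have hNq : w⁻ * q = w⁻ := by
    have := congrArg star hqN
    simpa [hqp.isSelfAdjoint.star_eq, hN.isSelfAdjoint.star_eq] using this
  have e1 : w⁺ = (1 - q) * a * (1 - q) - (1 - q) * b * (1 - q) := by
    have h : (1 - q) * a * (1 - q) - (1 - q) * b * (1 - q) = (1 - q) * (w⁺ - w⁻) * (1 - q) := by
      rw [hdec, hw]; noncomm_ring
    rw [h]
    simp only [mul_sub, sub_mul, one_mul, mul_one, hqP, hPq, hqN, hNq]
    simp
  have e2 : w⁻ = q * b * q - q * a * q := by
    have h : q * b * q - q * a * q = - (q * (w⁺ - w⁻) * q) := by rw [hdec, hw]; noncomm_ring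
    rw [h]
    simp only [mul_sub, sub_mul, hqP, hqN, hNq]
    simp
  have conj_nonneg : ∀ {r c : E →L[ℂ] E}, IsStarProjection r → 0 ≤ c → 0 ≤ r * c * r := by
    intro r c hr hc
    have := star_left_conjugate_nonneg hc r
    rwa [hr.isSelfAdjoint.star_eq] at this
  have l1 : posTrace w⁺ ≤ posTrace a := by
    refine le_trans (posTrace_mono ?_) (posTrace_conj_le hpp ha)
    rw [e1]
    exact sub_le_self _ (conj_nonneg hpp hb)
  have l2 : posTrace w⁻ ≤ posTrace b := by
    refine le_trans (posTrace_mono ?_) (posTrace_conj_le hqp hb)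
    rw [e2]
    exact sub_le_self _ (conj_nonneg hqp ha)
  rw [traceNorm, ← CFC.posPart_add_negPart w hwsa, posTrace_add hP hN]
  exact add_le_add l1 l2

lemma traceNorm_eq {u : E →L[ℂ] E} (hu : IsSelfAdjoint u) :
    traceNorm u = posTrace u⁺ + posTrace u⁻ := by
  rw [traceNorm, ← CFC.posPart_add_negPart u hu,
    posTrace_add (CFC.posPart_nonneg u) (CFC.negPart_nonneg u)]

lemma traceNorm_add_le {u v : E →L[ℂ] E} (hu : IsSelfAdjoint u) (hv : IsSelfAdjoint v) :
    traceNorm (u + v) ≤ traceNorm u + traceNorm v := by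
  have e : u + v = (u⁺ + v⁺) - (u⁻ + v⁻) := by
    conv_lhs => rw [← CFC.posPart_sub_negPart u hu, ← CFC.posPart_sub_negPart v hv]
    abel
  have hu1 := CFC.posPart_nonneg u
  have hu2 := CFC.negPart_nonneg u
  have hv1 := CFC.posPart_nonneg v
  have hv2 := CFC.negPart_nonneg v
  rw [e]
  refine (traceNorm_sub_le (add_nonneg hu1 hv1) (add_nonneg hu2 hv2)).trans ?_
  rw [posTrace_add hu1 hv1, posTrace_add hu2 hv2, traceNorm_eq hu, traceNorm_eq hv]
  exact le_of_eq (by ring)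

lemma traceNorm_zero : traceNorm (0 : E →L[ℂ] E) = 0 := by
  simp [traceNorm, posTrace_zero]

lemma traceNorm_neg (u : E →L[ℂ] E) : traceNorm (-u) = traceNorm u := by
  simp [traceNorm]

lemma traceNorm_smul (r : ℝ) (u : E →L[ℂ] E) :
    traceNorm (r • u) = ENNReal.ofReal |r| * traceNorm u := by
  have : CFC.abs (r • u) = |r| • CFC.abs u := by
    rw [CFC.abs_smul]; rfl
  rw [traceNorm, this, posTrace_smul (abs_nonneg r), traceNorm]

lemma eq_zero_of_traceNorm_eq_zero {u : E →L[ℂ] E} (h : traceNorm u = 0) : u = 0 := by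
  have ha : 0 ≤ CFC.abs u := CFC.abs_nonneg u
  have hs : IsSelfAdjoint (CFC.sqrt (CFC.abs u)) := (CFC.sqrt_nonneg _).isSelfAdjoint
  rw [traceNorm, posTrace, ENNReal.tsum_eq_zero] at h
  have h0 : ∀ i, CFC.sqrt (CFC.abs u) (stdBasis E i) = 0 := by
    intro i
    have := h i
    rw [inner_eq_norm_sqrt_sq ha, ENNReal.ofReal_eq_zero] at this
    have h2 : ‖CFC.sqrt (CFC.abs u) (stdBasis E i)‖ ^ 2 = 0 := le_antisymm this (by positivity)
    simpa using h2
  have h1 : CFC.sqrt (CFC.abs u) = 0 := by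
    ext x
    have hp := parseval (stdBasis E) (CFC.sqrt (CFC.abs u) x)
    have hz : ∀ j, ⟪stdBasis E j, CFC.sqrt (CFC.abs u) x⟫_ℂ = 0 := by
      intro j
      rw [← ContinuousLinearMap.adjoint_inner_left, ← ContinuousLinearMap.star_eq_adjoint,
        hs.star_eq, h0 j, inner_zero_left]
    simp only [hz] at hp
    simpa using hp
  have h2 : CFC.abs u = 0 := by
    rw [← CFC.sqrt_mul_sqrt_self (CFC.abs u) ha, h1, mul_zero]
  exact CFC.abs_eq_zero_iff.1 h2

end Trace

/-! ### The real Banach space of self-adjoint trace-class operators -/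

section SelfAdjointTraceClass

variable (E : Type*) [NormedAddCommGroup E] [InnerProductSpace ℂ E] [CompleteSpace E]

/-- The real vector space of self-adjoint trace-class operators on `E`. -/
def saTraceClass : Submodule ℝ (E →L[ℂ] E) where
  carrier := {u | IsSelfAdjoint u ∧ IsTraceClass u}
  zero_mem' := ⟨.zero _, by simp [IsTraceClass, traceNorm_zero]⟩
  add_mem' := fun hu hv => ⟨hu.1.add hv.1,
    (traceNorm_add_le hu.1 hv.1).trans_lt (ENNReal.add_lt_top.2 ⟨hu.2, hv.2⟩)⟩
  smul_mem' := fun r u hu => ⟨(IsSelfAdjoint.all r).smul hu.1, by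
    rw [IsTraceClass, traceNorm_smul]
    exact ENNReal.mul_lt_top ENNReal.ofReal_lt_top hu.2⟩

/-- The space of self-adjoint trace-class operators on `E`. It is a separate type (not just the
subtype) so that it carries the trace norm and not the operator norm. -/
def C1sa : Type _ := saTraceClass E

instance : AddCommGroup (C1sa E) := inferInstanceAs (AddCommGroup (saTraceClass E))

instance : Module ℝ (C1sa E) := inferInstanceAs (Module ℝ (saTraceClass E))

variable {E}

/-- The bounded operator underlying an element of `C1sa E`, as a real linear map. -/
def C1sa.toOp : C1sa E →ₗ[ℝ] (E →L[ℂ] E) := (saTraceClass E).subtype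

lemma C1sa.toOp_injective : Function.Injective (C1sa.toOp (E := E)) :=
  Subtype.val_injective

lemma C1sa.isSelfAdjoint (u : C1sa E) : IsSelfAdjoint u.toOp := u.2.1

lemma C1sa.isTraceClass (u : C1sa E) : IsTraceClass u.toOp := u.2.2

/-- The trace norm `‖u‖ = Tr |u|` as a norm on `C1sa E`. -/
instance : NormedAddCommGroup (C1sa E) :=
  AddGroupNorm.toNormedAddCommGroup
    { toFun := fun u => (traceNorm u.toOp).toReal
      map_zero' := by simp [traceNorm_zero]
      add_le' := fun u v => by
        rw [map_add, ← ENNReal.toReal_add u.isTraceClass.ne v.isTraceClass.ne]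
        exact ENNReal.toReal_mono
          (ENNReal.add_lt_top.2 ⟨u.isTraceClass, v.isTraceClass⟩).ne
          (traceNorm_add_le u.isSelfAdjoint v.isSelfAdjoint)
      neg' := fun u => by rw [map_neg, traceNorm_neg]
      eq_zero_of_map_eq_zero' := fun u hu => by
        have h := (ENNReal.toReal_eq_zero_iff _).1 hu
        have h0 := eq_zero_of_traceNorm_eq_zero (h.resolve_right u.isTraceClass.ne)
        exact C1sa.toOp_injective (by rw [h0, map_zero]) }

lemma C1sa.norm_def (u : C1sa E) : ‖u‖ = (traceNorm u.toOp).toReal := rfl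

instance : NormedSpace ℝ (C1sa E) where
  norm_smul_le := fun r u => by
    rw [C1sa.norm_def, C1sa.norm_def, map_smul, traceNorm_smul, ENNReal.toReal_mul,
      ENNReal.toReal_ofReal (abs_nonneg r), Real.norm_eq_abs]

/-- The trace `Tr u`, the sum of `⟪e i, u (e i)⟫` over an orthonormal basis `e`. The sum converges
absolutely, and it is real because `u` is self-adjoint. -/
def C1sa.tr (u : C1sa E) : ℝ :=
  ∑' i, (⟪stdBasis E i, u.toOp (stdBasis E i)⟫_ℂ).re

lemma hasSum_posTrace {ι : Type*} (b : HilbertBasis ι ℂ E) {a : E →L[ℂ] E} (ha : 0 ≤ a)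
    (h : posTrace a ≠ ⊤) :
    HasSum (fun i => (⟪b i, a (b i)⟫_ℂ).re) (posTrace a).toReal := by
  rw [posTrace_eq_basis b ha] at h ⊢
  rw [ENNReal.tsum_toReal_eq (ENNReal.ne_top_of_tsum_ne_top h)]
  have := ENNReal.hasSum_toReal h
  simpa only [ENNReal.toReal_ofReal (re_inner_nonneg ha _)] using this

lemma C1sa.hasSum_posTrace_sub {ι : Type*} (b : HilbertBasis ι ℂ E) (u : C1sa E) :
    HasSum (fun i => (⟪b i, u.toOp (b i)⟫_ℂ).re)
      ((posTrace u.toOp⁺).toReal - (posTrace u.toOp⁻).toReal) := by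
  have hsum := u.isTraceClass
  rw [IsTraceClass, traceNorm_eq u.isSelfAdjoint, ENNReal.add_lt_top] at hsum
  have h := (hasSum_posTrace b (CFC.posPart_nonneg u.toOp) hsum.1.ne).sub
    (hasSum_posTrace b (CFC.negPart_nonneg u.toOp) hsum.2.ne)
  have e : ∀ x : E, (⟪x, u.toOp x⟫_ℂ).re
      = (⟪x, u.toOp⁺ x⟫_ℂ).re - (⟪x, u.toOp⁻ x⟫_ℂ).re := by
    intro x
    have h1 := congrArg (fun T : E →L[ℂ] E => T x) (CFC.posPart_sub_negPart u.toOp u.isSelfAdjoint)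
    rw [← Complex.sub_re, ← inner_sub_right]
    exact congrArg (fun y => (⟪x, y⟫_ℂ).re) h1.symm
  simpa only [e] using h

/-- The series defining the trace converges, in any orthonormal basis, to the same value. -/
lemma C1sa.hasSum_tr {ι : Type*} (b : HilbertBasis ι ℂ E) (u : C1sa E) :
    HasSum (fun i => (⟪b i, u.toOp (b i)⟫_ℂ).re) u.tr := by
  rw [C1sa.tr, (u.hasSum_posTrace_sub (stdBasis E)).tsum_eq]
  exact u.hasSum_posTrace_sub b

/-- `u ≥ 0`, i.e. `u` belongs to the cone of positive trace-class operators. -/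
def C1sa.IsPos (u : C1sa E) : Prop :=
  u.toOp.IsPositive

end SelfAdjointTraceClass

/-! ### Semigroups -/

section Semigroup

variable {X : Type*} [NormedAddCommGroup X] [NormedSpace ℝ X]

/-- `(T t)` for `t > 0` is a `C₀`-semigroup on `X`. (Values at `t ≤ 0` are irrelevant.) -/
structure IsC0Semigroup (T : ℝ → X →L[ℝ] X) : Prop where
  add : ∀ s t : ℝ, 0 < s → 0 < t → T (s + t) = (T s).comp (T t)
  tendsto : ∀ u : X, Tendsto (fun t => T t u) (𝓝[>] 0) (𝓝 u)

/-- The operator `A` (with its domain) is the generator of `(T t)` for `t > 0`: one has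
`u ∈ D(A)` and `A u = y` if and only if `t⁻¹ (T t u - u)` tends to `y` as `t ↓ 0`. -/
def IsGenerator (A : X →ₗ.[ℝ] X) (T : ℝ → X →L[ℝ] X) : Prop :=
  ∀ u y : X, (u, y) ∈ A.graph ↔ Tendsto (fun t : ℝ => t⁻¹ • (T t u - u)) (𝓝[>] 0) (𝓝 y)

end Semigroup

/-! ### Functional regularisations and the regularised semigroup -/

section Regularisation

variable {E : Type*} [NormedAddCommGroup E] [InnerProductSpace ℂ E] [CompleteSpace E]

/-- An operator `A` with domain `D` is positivity preserving. -/
def PosPreserving {D : Submodule ℝ (C1sa E)} (A : D →ₗ[ℝ] C1sa E) : Prop :=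
  ∀ u : D, (u : C1sa E).IsPos → (A u).IsPos

/-- A dynamical semigroup: a positivity preserving contraction `C₀`-semigroup on `C1sa E`. -/
structure IsDynamicalSemigroup (T : ℝ → C1sa E →L[ℝ] C1sa E) : Prop where
  isC0Semigroup : IsC0Semigroup T
  norm_le_one : ∀ t : ℝ, 0 < t → ‖T t‖ ≤ 1
  pos : ∀ t : ℝ, 0 < t → ∀ u : C1sa E, u.IsPos → (T t u).IsPos

/-- The net `(Kα)` is a functional regularisation of the operator `K : D(H) → C1sa E`. -/
structure IsFunctionalRegularisation (H : C1sa E →ₗ.[ℝ] C1sa E) (K : H.domain →ₗ[ℝ] C1sa E)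
    {J : Type*} [Preorder J] (Kα : J → H.domain →ₗ[ℝ] C1sa E) : Prop where
  posPreserving : ∀ α, PosPreserving (Kα α)
  trace_le : ∀ α, ∃ a b : ℝ, 0 ≤ a ∧ 0 ≤ b ∧ b < 1 ∧
    ∀ u : H.domain, (u : C1sa E).IsPos → (Kα α u).tr ≤ a * (u : C1sa E).tr + b * (H u).tr
  mono : ∀ α β, α ≤ β → PosPreserving (Kα β - Kα α)
  le : ∀ α, PosPreserving (K - Kα α)
  tendsto : ∀ u : H.domain, (u : C1sa E).IsPos →
    ∃ V : Submodule ℂ E, Dense (V : Set E) ∧ ∀ x ∈ V,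
      Tendsto (fun α => ⟪(Kα α u).toOp x, x⟫_ℂ) atTop (𝓝 ⟪(K u).toOp x, x⟫_ℂ)

/-- The operator `H - B` with domain `D(H)`, for `B : D(H) → C1sa E`. -/
def perturb (H : C1sa E →ₗ.[ℝ] C1sa E) (B : H.domain →ₗ[ℝ] C1sa E) :
    C1sa E →ₗ.[ℝ] C1sa E :=
  ⟨H.domain, H.toFun - B⟩

/-- `(T t)` for `t > 0` is the semigroup constructed from the net `(Kα)`: for every `α` the operator
`-(H - Kα α)` generates a `C₀`-semigroup `Tα α`, and `T t u = lim_α Tα α t u` in trace norm.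
(A generator determines its semigroup, so at most one family `(T t)`, `t > 0`, is constructed from
a given directed net.) -/
def IsRegularisedSemigroup (H : C1sa E →ₗ.[ℝ] C1sa E)
    {J : Type*} [Preorder J] (Kα : J → H.domain →ₗ[ℝ] C1sa E)
    (T : ℝ → C1sa E →L[ℝ] C1sa E) : Prop :=
  ∃ Tα : J → ℝ → C1sa E →L[ℝ] C1sa E,
    (∀ α, IsC0Semigroup (Tα α) ∧ IsGenerator (-(perturb H (Kα α))) (Tα α)) ∧
    ∀ t : ℝ, 0 < t → ∀ u : C1sa E, Tendsto (fun α => Tα α t u) atTop (𝓝 (T t u))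

end Regularisation

end

end KatoReg

/-! Only the order structure of the space matters: on the positive cone the trace norm is the linear
functional `Tr`, and every `u` is a difference of positive elements whose norms add up to that of
`u` (`IsAdditiveNorm`).

Generation. For `r > a / (1 - b)` the operator `K_α (r + H)⁻¹` is positive with norm at most `b + a
/ r < 1`, so a Neumann series inverts `r + H - K_α` positively. Since `Tr (K_α u) ≤ Tr (K u) ≤ Tr (H
u)`, positive solutions satisfy `r ‖u‖ ≤ ‖f‖`, and Hille–Yosida applies
(`exists_perturbed_semigroup`).

Limit. Differentiating `s ↦ V (t - s) (U s u)` shows that ordered generators give ordered semigroups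
(`IsSemigroup.sub_mem`). Thus the semigroups increase with `α`; being contractions they converge in
norm on the cone, where increasing nets of bounded trace are Cauchy. All lie above the semigroup of
`-H`, which controls them uniformly near time zero, so the limit is strongly continuous
(`exists_limit_of_monotone`).

Uniqueness. The weak convergence `K_α u → K u` is in fact trace-norm convergence by monotonicity
(`tendsto_of_tendsto_inner`), so the generator of the limit extends `K - H` on positive elements of
`D(H)`. Any positive contraction semigroup with this property dominates every approximating
semigroup of either net, hence both limits (`sub_mem_of_tendsto`). Each limit therefore dominates
the other, and they coincide. -/

namespace KatoReg

/-! ### Strongly continuous semigroups: local bounds, comparison by generators, resolvents. -/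

section Semigroups

variable {X : Type*} [NormedAddCommGroup X] [NormedSpace ℝ X]

/-- Neumann series, with a positive solution if the operator and the datum are positive. -/
lemma exists_sub_apply_eq [CompleteSpace X] {C : ProperCone ℝ X} {P : X →L[ℝ] X} (hP : ‖P‖ < 1)
    (hPC : ∀ u ∈ C, P u ∈ C) (f : X) : ∃ g, g - P g = f ∧ (f ∈ C → g ∈ C) := by
  refine ⟨(∑' n : ℕ, P ^ n) f, ?_, fun hf => ?_⟩
  · have := congrArg (fun A : X →L[ℝ] X => A f) (mul_neg_geom_series P hP)
    simpa [sub_mul] using this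
  · have h1 := (summable_geometric_of_norm_lt_one hP).hasSum.mapL (ContinuousLinearMap.apply ℝ X f)
    have h2 : ∀ n : ℕ, (P ^ n) f ∈ C := fun n => by
      induction n with
      | zero => simpa using hf
      | succ n ih => rw [pow_succ']; exact hPC _ ih
    exact C.isClosed.mem_of_tendsto h1 (Eventually.of_forall fun s => sum_mem fun n _ => h2 n)

/-- A strongly continuous semigroup, extended by the identity to nonpositive times. -/
structure IsSemigroup (T : ℝ → X →L[ℝ] X) : Prop where
  eq_one : ∀ t ≤ 0, T t = 1
  add : ∀ s t, 0 ≤ s → 0 ≤ t → T (s + t) = T s * T t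
  cont : ∀ u, Continuous fun t => T t u

/-- `u` belongs to the domain of the generator of `T`, which maps `u` to `y`. -/
def HasGen (T : ℝ → X →L[ℝ] X) (u y : X) : Prop :=
  Tendsto (fun t : ℝ => t⁻¹ • (T t u - u)) (𝓝[>] 0) (𝓝 y)

/-- The extension of a family of operators by the identity to nonpositive times. -/
noncomputable def extendOne (T : ℝ → X →L[ℝ] X) (t : ℝ) : X →L[ℝ] X :=
  if 0 < t then T t else 1

lemma extendOne_of_pos (T : ℝ → X →L[ℝ] X) {t : ℝ} (ht : 0 < t) : extendOne T t = T t :=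
  if_pos ht

lemma hasGen_congr {S T : ℝ → X →L[ℝ] X} (h : ∀ t, 0 < t → S t = T t) {u y : X} :
    HasGen S u y ↔ HasGen T u y :=
  tendsto_congr' (by filter_upwards [self_mem_nhdsWithin] with t ht; rw [h t ht])

lemma hasGen_extendOne {T : ℝ → X →L[ℝ] X} {u y : X} :
    HasGen (extendOne T) u y ↔ HasGen T u y :=
  hasGen_congr fun _ ht => extendOne_of_pos T ht

/-- Otherwise there are times `τ n → 0` with `‖T (τ n)‖ > n`, although `T (τ n) u → u` bounds every
orbit; this contradicts Banach–Steinhaus. -/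
lemma IsC0Semigroup.exists_bound_near_zero [CompleteSpace X] {T : ℝ → X →L[ℝ] X}
    (hT : IsC0Semigroup T) : ∃ δ > 0, ∃ M, ∀ t, 0 < t → t ≤ δ → ‖T t‖ ≤ M := by
  by_contra! h
  choose τ hτ0 hτ1 hτ using fun n : ℕ => h (1 / ((n : ℝ) + 1)) (by positivity) n
  have hlim : Tendsto τ atTop (𝓝[>] 0) := by
    refine tendsto_nhdsWithin_iff.2 ⟨?_, Eventually.of_forall hτ0⟩
    exact squeeze_zero (fun n => (hτ0 n).le) hτ1 tendsto_one_div_add_atTop_nhds_zero_nat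
  obtain ⟨C, hC⟩ := banach_steinhaus (g := fun n => T (τ n)) fun u => by
    obtain ⟨C, hC⟩ := isBounded_iff_forall_norm_le.1
      (Metric.isBounded_range_of_tendsto _ ((hT.tendsto u).comp hlim))
    exact ⟨C, fun n => hC _ ⟨n, rfl⟩⟩
  obtain ⟨n, hn⟩ := exists_nat_gt C
  exact absurd (hC n) (not_le.2 (hn.trans (hτ n)))

lemma extendOne_add {T : ℝ → X →L[ℝ] X}
    (hT : ∀ s t : ℝ, 0 < s → 0 < t → T (s + t) = (T s).comp (T t)) (s t : ℝ)
    (hs : 0 ≤ s) (ht : 0 ≤ t) : extendOne T (s + t) = extendOne T s * extendOne T t := by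
  rcases hs.eq_or_lt with rfl | hs'
  · simp [extendOne]
  rcases ht.eq_or_lt with rfl | ht'
  · simp [extendOne]
  rw [extendOne_of_pos T hs', extendOne_of_pos T ht', extendOne_of_pos T (by positivity),
    hT s t hs' ht']
  rfl

lemma IsC0Semigroup.exists_bound [CompleteSpace X] {T : ℝ → X →L[ℝ] X}
    (hT : IsC0Semigroup T) (b : ℝ) : ∃ M, 0 ≤ M ∧ ∀ t ≤ b, ‖extendOne T t‖ ≤ M := by
  obtain ⟨δ, hδ, M, hM⟩ := hT.exists_bound_near_zero
  -- A bound at least one also covers the identity at nonpositive times and has nondecreasing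
  -- powers; each step of length `δ` costs one factor `L`.
  set L := max M 1 with hL
  have hL1 : 1 ≤ L := le_max_right _ _
  have h0 : ∀ t ≤ δ, ‖extendOne T t‖ ≤ L := by
    intro t ht
    by_cases h : 0 < t
    · rw [extendOne_of_pos T h]
      exact (hM t h ht).trans (le_max_left _ _)
    · rw [extendOne, if_neg h]
      exact ContinuousLinearMap.norm_id_le.trans hL1
  have key : ∀ n : ℕ, ∀ t ≤ (n + 1) * δ, ‖extendOne T t‖ ≤ L ^ (n + 1) := by
    intro n
    induction n with
    | zero => intro t ht; simpa using h0 t (by simpa using ht)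
    | succ n ih =>
      intro t ht
      by_cases h : t ≤ δ
      · exact (h0 t h).trans (le_self_pow₀ hL1 (by omega))
      · push Not at h
        have e : t = (t - δ) + δ := by ring
        rw [e, extendOne_add hT.add _ _ (by linarith) hδ.le, pow_succ]
        refine (norm_mul_le _ _).trans ?_
        gcongr
        · exact ih _ (by push_cast at ht; linarith)
        · exact h0 _ le_rfl
  obtain ⟨n, hn⟩ := exists_nat_gt (b / δ)
  refine ⟨L ^ (n + 1), by positivity, fun t ht => key n t (ht.trans ?_)⟩
  rw [div_lt_iff₀ hδ] at hn
  nlinarith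

/-- For `0 ≤ a ≤ b` the increment of an orbit is `T a (T (b - a) u - u)`. The local bound on `‖T a‖`
thus reduces continuity from both sides at any time to right continuity at zero. With the identity
at `t ≤ 0` orbits are continuous on all of `ℝ`. -/
lemma IsC0Semigroup.isSemigroup_extendOne [CompleteSpace X] {T : ℝ → X →L[ℝ] X}
    (hT : IsC0Semigroup T) : IsSemigroup (extendOne T) where
  eq_one t ht := if_neg ht.not_gt
  add := extendOne_add hT.add
  cont u := by
    have h0 : Tendsto (fun t => extendOne T t u) (𝓝 0) (𝓝 u) := by
      rw [← nhdsLE_sup_nhdsGT, tendsto_sup]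
      constructor
      · refine tendsto_const_nhds.congr' ?_
        filter_upwards [self_mem_nhdsWithin] with t ht
        rw [extendOne, if_neg (not_lt.2 ht)]
        rfl
      · refine (hT.tendsto u).congr' ?_
        filter_upwards [self_mem_nhdsWithin] with t ht
        rw [extendOne_of_pos T ht]
    have hmax : ∀ t, extendOne T t = extendOne T (max t 0) := by
      intro t
      rcases le_total t 0 with h | h
      · rw [max_eq_right h, extendOne, extendOne, if_neg h.not_gt, if_neg (lt_irrefl _)]
      · rw [max_eq_left h]
    rw [continuous_iff_continuousAt]
    intro s
    obtain ⟨M, hM0, hM⟩ := hT.exists_bound (max s 0 + 1)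
    have hd : Tendsto (fun t : ℝ => |max t 0 - max s 0|) (𝓝 s) (𝓝 0) := by
      have : Continuous fun t : ℝ => |max t 0 - max s 0| := by fun_prop
      simpa using this.tendsto s
    have hz : Tendsto (fun t => M * ‖extendOne T (|max t 0 - max s 0|) u - u‖) (𝓝 s) (𝓝 0) := by
      simpa using (((h0.comp hd).sub_const u).norm).const_mul M
    have hinc : ∀ a b : ℝ, 0 ≤ a → a ≤ b → a ≤ max s 0 + 1 →
        ‖extendOne T b u - extendOne T a u‖ ≤ M * ‖extendOne T (b - a) u - u‖ := by
      intro a b ha hab has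
      have e : extendOne T b u = extendOne T a (extendOne T (b - a) u) := by
        have := extendOne_add hT.add a (b - a) ha (by linarith)
        rw [add_sub_cancel] at this
        rw [this]; rfl
      rw [e, ← map_sub]
      exact (extendOne T a).le_of_opNorm_le (hM a has) _
    rw [ContinuousAt, tendsto_iff_norm_sub_tendsto_zero]
    refine squeeze_zero' (Eventually.of_forall fun _ => norm_nonneg _) ?_ hz
    filter_upwards [Iio_mem_nhds (lt_add_one s)] with t ht
    rw [hmax t, hmax s]
    have ht1 : max t 0 ≤ max s 0 + 1 :=
      max_le (ht.le.trans (by linarith [le_max_left s 0])) (by linarith [le_max_right s 0])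
    rcases le_total (max t 0) (max s 0) with h | h
    · rw [norm_sub_rev, abs_sub_comm, abs_of_nonneg (sub_nonneg.2 h)]
      exact hinc _ _ (le_max_right _ _) h ht1
    · rw [abs_of_nonneg (sub_nonneg.2 h)]
      exact hinc _ _ (le_max_right _ _) h (by linarith)

lemma tendsto_sub_nhdsGT (s : ℝ) : Tendsto (fun r => r - s) (𝓝[>] s) (𝓝[>] 0) := by
  refine tendsto_nhdsWithin_iff.2 ⟨?_, ?_⟩
  · have : Continuous fun r : ℝ => r - s := by fun_prop
    simpa using (this.tendsto s).mono_left nhdsWithin_le_nhds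
  · filter_upwards [self_mem_nhdsWithin] with r hr using sub_pos.2 (Set.mem_Ioi.1 hr)

namespace IsSemigroup

variable {T U V : ℝ → X →L[ℝ] X}

lemma isC0Semigroup (hT : IsSemigroup T) : IsC0Semigroup T where
  add s t hs ht := hT.add s t hs.le ht.le
  tendsto u := by
    have := (hT.cont u).tendsto 0
    rw [hT.eq_one 0 le_rfl] at this
    exact this.mono_left nhdsWithin_le_nhds

lemma extendOne_eq (hT : IsSemigroup T) : extendOne T = T := by
  funext t
  by_cases h : 0 < t
  · exact extendOne_of_pos T h
  · rw [extendOne, if_neg h, hT.eq_one t (not_lt.1 h)]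

lemma exists_bound [CompleteSpace X] (hT : IsSemigroup T) (b : ℝ) :
    ∃ M, 0 ≤ M ∧ ∀ t ≤ b, ‖T t‖ ≤ M := by
  simpa only [hT.extendOne_eq] using hT.isC0Semigroup.exists_bound b

lemma add_apply (hT : IsSemigroup T) {s t : ℝ} (hs : 0 ≤ s) (ht : 0 ≤ t) (u : X) :
    T (s + t) u = T s (T t u) := by
  rw [hT.add s t hs ht]; rfl

lemma comm_apply (hT : IsSemigroup T) {s t : ℝ} (hs : 0 ≤ s) (ht : 0 ≤ t) (u : X) :
    T s (T t u) = T t (T s u) := by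
  rw [← hT.add_apply hs ht, add_comm, hT.add_apply ht hs]

lemma zero_apply (hT : IsSemigroup T) (u : X) : T 0 u = u := by
  rw [hT.eq_one 0 le_rfl]; rfl

/-- Strong continuity becomes joint continuity because `‖T t‖` is locally bounded. This is what
allows `V (t - r) (U r u)` to be differentiated. -/
lemma tendsto_apply [CompleteSpace X] (hT : IsSemigroup T) {ι : Type*} {l : Filter ι}
    {τ : ι → ℝ} {c : ι → X} {t : ℝ} {u : X} (hτ : Tendsto τ l (𝓝 t)) (hc : Tendsto c l (𝓝 u)) :
    Tendsto (fun i => T (τ i) (c i)) l (𝓝 (T t u)) := by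
  obtain ⟨M, hM0, hM⟩ := hT.exists_bound (t + 1)
  have h1 : Tendsto (fun i => T (τ i) (c i - u)) l (𝓝 0) := by
    have hz : Tendsto (fun i => M * ‖c i - u‖) l (𝓝 0) := by
      simpa using ((hc.sub_const u).norm).const_mul M
    refine squeeze_zero_norm' ?_ hz
    filter_upwards [hτ.eventually (Iio_mem_nhds (lt_add_one t))] with i hi
    exact (T (τ i)).le_of_opNorm_le (hM _ hi.le) _
  have h2 : Tendsto (fun i => T (τ i) u) l (𝓝 (T t u)) := ((hT.cont u).tendsto t).comp hτ
  simpa using h1.add h2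

lemma hasGen_apply (hT : IsSemigroup T) {u y : X} (h : HasGen T u y) {s : ℝ} (hs : 0 ≤ s) :
    HasGen T (T s u) (T s y) := by
  refine (((T s).continuous.tendsto y).comp h).congr' ?_
  filter_upwards [self_mem_nhdsWithin] with t ht
  simp only [Function.comp_apply, map_smul, map_sub]
  rw [hT.comm_apply hs (le_of_lt ht)]

/-- Variation of constants: the right derivative of `s ↦ V (t - s) (U s u)`. -/
lemma hasDerivWithinAt_comp [CompleteSpace X] (hU : IsSemigroup U) (hV : IsSemigroup V)
    {s t : ℝ} (hs : 0 ≤ s) (hst : s < t) {u y z : X} (hy : HasGen U (U s u) y)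
    (hz : HasGen V (U s u) z) :
    HasDerivWithinAt (fun r => V (t - r) (U r u)) (V (t - s) (y - z)) (Set.Ici s) s := by
  -- As `V (t - s) = V (t - s - h) V h`, the difference quotient is `V (t - s - h)` applied to this
  -- expression, so only generator values at `U s u` enter.
  have h1 : Tendsto (fun h : ℝ => h⁻¹ • (U h (U s u) - V h (U s u))) (𝓝[>] 0) (𝓝 (y - z)) := by
    refine (hy.sub hz).congr fun h => ?_
    rw [← smul_sub]; abel_nf
  have h2 : Tendsto (fun h : ℝ => t - s - h) (𝓝[>] 0) (𝓝 (t - s)) := by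
    have : Continuous fun h : ℝ => t - s - h := by fun_prop
    simpa using (this.tendsto 0).mono_left nhdsWithin_le_nhds
  have h3 := hV.tendsto_apply h2 h1
  rw [hasDerivWithinAt_iff_tendsto_slope, Set.Ici_sdiff_left]
  refine (h3.comp (tendsto_sub_nhdsGT s)).congr' ?_
  filter_upwards [self_mem_nhdsWithin, nhdsWithin_le_nhds (Iio_mem_nhds hst)] with r hr hrt
  have hr : s < r := hr
  have hrt : r < t := hrt
  rw [Function.comp_apply, map_smul, map_sub, ← hU.add_apply (by linarith) hs,
    ← hV.add_apply (by linarith) (by linarith), slope_def_module]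
  congr 4 <;> ring_nf

lemma continuous_comp [CompleteSpace X] (hU : IsSemigroup U) (hV : IsSemigroup V) (t : ℝ) (u : X) :
    Continuous fun r => V (t - r) (U r u) := by
  rw [continuous_iff_continuousAt]
  intro r
  exact hV.tendsto_apply ((continuous_const.sub continuous_id).tendsto r) ((hU.cont u).tendsto r)

lemma hasDerivWithinAt_orbit (hT : IsSemigroup T) {u y : X} (h : HasGen T u y) {s : ℝ}
    (hs : 0 ≤ s) : HasDerivWithinAt (fun r => T r u) (T s y) (Set.Ici s) s := by
  rw [hasDerivWithinAt_iff_tendsto_slope, Set.Ici_sdiff_left]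
  refine ((hT.hasGen_apply h hs).comp (tendsto_sub_nhdsGT s)).congr' ?_
  filter_upwards [self_mem_nhdsWithin] with r hr
  have hr : s < r := hr
  rw [Function.comp_apply, ← hT.add_apply (by linarith) hs, slope_def_module, sub_add_cancel]

/-- Mean value inequality for `s ↦ T s u - s • y`. The error depends only on the modulus of
continuity at `y`, so the estimate survives limits of semigroups. -/
lemma norm_sub_sub_smul_le (hT : IsSemigroup T) {u y : X} (h : HasGen T u y) {t ε : ℝ}
    (ht : 0 ≤ t) (hε : ∀ s, 0 ≤ s → s < t → ‖T s y - y‖ ≤ ε) :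
    ‖T t u - u - t • y‖ ≤ ε * t := by
  have := norm_image_sub_le_of_norm_deriv_right_le_segment (f := fun s => T s u - s • y)
    (f' := fun s => T s y - y) (a := 0) (b := t) (C := ε)
    (((hT.cont u).sub (by fun_prop)).continuousOn)
    (fun s hs => by
      have h1 := hT.hasDerivWithinAt_orbit h hs.1
      have h2 : HasDerivWithinAt (fun s : ℝ => s • y) ((1 : ℝ) • y) (Set.Ici s) s :=
        ((hasDerivAt_id s).smul_const y).hasDerivWithinAt
      simpa only [one_smul] using! h1.sub h2)
    (fun s hs => hε s hs.1 hs.2) t ⟨ht, le_rfl⟩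
  simpa [hT.zero_apply, sub_right_comm] using this

/-- The path `s ↦ V (t - s) (U s u)` runs from `V t u` to `U t u` with right derivative in `-C`. A
functional separating `V t u - U t u` from `C` would be nonincreasing along it, which is a
contradiction. -/
lemma sub_mem_of_hasGen [CompleteSpace X] {C : ProperCone ℝ X} (hU : IsSemigroup U)
    (hV : IsSemigroup V) (hUC : ∀ t, ∀ u ∈ C, U t u ∈ C) (hVC : ∀ t, ∀ u ∈ C, V t u ∈ C)
    (h : ∀ u ∈ C, ∀ y, HasGen U u y → ∃ z, HasGen V u z ∧ z - y ∈ C)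
    {u y : X} (hu : u ∈ C) (hy : HasGen U u y) (t : ℝ) : V t u - U t u ∈ C := by
  rcases le_or_gt t 0 with ht | ht
  · rw [hU.eq_one t ht, hV.eq_one t ht, sub_self]; exact C.zero_mem
  by_contra hn
  obtain ⟨f, hf, hf0⟩ := C.hyperplane_separation_point hn
  have hle := image_le_of_deriv_right_le_deriv_boundary
    (f := fun r => f (V (t - r) (U r u)))
    (f' := fun s => derivWithin (fun r => f (V (t - r) (U r u))) (Set.Ici s) s)
    (B := fun _ => f (V t u)) (B' := fun _ => 0) (a := 0) (b := t)
    (f.continuous.comp (hU.continuous_comp hV t u)).continuousOn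
    (fun s hs => by
      obtain ⟨z, hz, -⟩ := h _ (hUC s u hu) _ (hU.hasGen_apply hy hs.1)
      have h1 := hU.hasDerivWithinAt_comp hV hs.1 hs.2 (hU.hasGen_apply hy hs.1) hz
      exact (f.hasFDerivAt.comp_hasDerivWithinAt s h1).differentiableWithinAt.hasDerivWithinAt)
    (by simp [hU.zero_apply]) continuousOn_const
    (fun s _ => hasDerivWithinAt_const _ _ _)
    (fun s hs => by
      obtain ⟨z, hz, hzy⟩ := h _ (hUC s u hu) _ (hU.hasGen_apply hy hs.1)
      have h1 := hU.hasDerivWithinAt_comp hV hs.1 hs.2 (hU.hasGen_apply hy hs.1) hz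
      have h2 := (f.hasFDerivAt.comp_hasDerivWithinAt s h1).derivWithin
        (uniqueDiffOn_Ici s s Set.self_mem_Ici)
      have h3 := hf _ (hVC (t - s) _ hzy)
      rw [← neg_sub (U s y) z, map_neg, map_neg] at h3
      simp only [Function.comp_def] at h2
      rw [h2]
      linarith) (x := t) ⟨ht.le, le_rfl⟩
  simp only [sub_self, hV.zero_apply] at hle
  rw [map_sub] at hf0
  linarith

/-- The generator of a contraction semigroup is dissipative. -/
lemma norm_le_of_hasGen (hT : ∀ t, ‖T t‖ ≤ 1) {u y : X} (h : HasGen T u y) (r : ℝ) :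
    r * ‖u‖ ≤ ‖r • u - y‖ := by
  have h1 : Tendsto (fun t : ℝ => ‖r • u - t⁻¹ • (T t u - u)‖) (𝓝[>] 0) (𝓝 ‖r • u - y‖) :=
    (h.const_sub _).norm
  refine ge_of_tendsto h1 ?_
  filter_upwards [self_mem_nhdsWithin] with t ht
  have ht : (0 : ℝ) < t := ht
  have e : r • u - t⁻¹ • (T t u - u) = (r + t⁻¹) • u - t⁻¹ • T t u := by
    rw [smul_sub, add_smul]; abel
  have h2 : ‖t⁻¹ • T t u‖ ≤ t⁻¹ * ‖u‖ := by
    rw [norm_smul, Real.norm_of_nonneg (by positivity)]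
    gcongr
    simpa using (T t).le_of_opNorm_le (hT t) u
  have h3 := norm_sub_norm_le ((r + t⁻¹) • u) (t⁻¹ • T t u)
  have h4 : (r + t⁻¹) * ‖u‖ ≤ ‖(r + t⁻¹) • u‖ := by
    rw [norm_smul]; gcongr; exact le_abs_self _
  rw [e]
  linarith

lemma hasDerivAt_integral [CompleteSpace X] (hT : IsSemigroup T) (u : X) (t : ℝ) :
    HasDerivAt (fun x => ∫ s in (0 : ℝ)..x, T s u) (T t u) t :=
  ((hT.cont u).integral_hasStrictDerivAt 0 t).hasDerivAt

lemma apply_integral [CompleteSpace X] (hT : IsSemigroup T) (u : X) {t h : ℝ} (ht : 0 ≤ t)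
    (hh : 0 ≤ h) : T h (∫ s in (0 : ℝ)..t, T s u)
      = (∫ s in (0 : ℝ)..(t + h), T s u) - ∫ s in (0 : ℝ)..h, T s u := by
  have hi : ∀ a b, IntervalIntegrable (fun s => T s u) MeasureTheory.volume a b :=
    fun a b => (hT.cont u).intervalIntegrable a b
  rw [← ContinuousLinearMap.intervalIntegral_comp_comm _ (hi 0 t),
    intervalIntegral.integral_interval_sub_left (hi _ _) (hi _ _)]
  have e : ∫ s in (0 : ℝ)..t, T h (T s u) = ∫ s in (0 : ℝ)..t, T (s + h) u := by
    refine intervalIntegral.integral_congr fun s hs => ?_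
    rw [Set.uIcc_of_le ht] at hs
    rw [add_comm, hT.add_apply hh hs.1]
  rw [e, intervalIntegral.integral_comp_add_right (fun s => T s u), zero_add]

/-- By `apply_integral` the difference quotient is the average of the orbit over `[t, t + h]` minus
its average over `[0, h]`. -/
lemma hasGen_integral [CompleteSpace X] (hT : IsSemigroup T) (u : X) {t : ℝ} (ht : 0 ≤ t) :
    HasGen T (∫ s in (0 : ℝ)..t, T s u) (T t u - u) := by
  have h1 := ((hT.hasDerivAt_integral u t).hasDerivWithinAt (s := Set.Ioi t))
  have h2 := ((hT.hasDerivAt_integral u 0).hasDerivWithinAt (s := Set.Ioi 0))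
  rw [hasDerivWithinAt_iff_tendsto_slope' (by simp)] at h1 h2
  rw [hT.zero_apply] at h2
  have h3 : Tendsto (fun h => t + h) (𝓝[>] 0) (𝓝[>] t) := by
    refine tendsto_nhdsWithin_iff.2 ⟨?_, ?_⟩
    · have : Continuous fun r : ℝ => t + r := by fun_prop
      simpa using (this.tendsto 0).mono_left nhdsWithin_le_nhds
    · filter_upwards [self_mem_nhdsWithin] with r hr
      have hr : 0 < r := hr
      exact lt_add_of_pos_right t hr
  refine ((h1.comp h3).sub h2).congr' ?_
  filter_upwards [self_mem_nhdsWithin] with h hh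
  have hh : 0 < h := hh
  rw [hT.apply_integral u ht hh.le, Function.comp_apply, slope_def_module, slope_def_module,
    ← sub_eq_zero]
  simp only [add_sub_cancel_left, sub_zero, intervalIntegral.integral_same, ← smul_sub]
  abel_nf
  simp

lemma integral_mem [CompleteSpace X] {C : ProperCone ℝ X} (hT : IsSemigroup T)
    (hTC : ∀ t, ∀ u ∈ C, T t u ∈ C) {u : X} (hu : u ∈ C) {t : ℝ} (ht : 0 ≤ t) :
    ∫ s in (0 : ℝ)..t, T s u ∈ C := by
  by_contra hn
  obtain ⟨f, hf, hf0⟩ := C.hyperplane_separation_point hn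
  rw [← f.intervalIntegral_comp_comm ((hT.cont u).intervalIntegrable 0 t)] at hf0
  exact absurd hf0 (not_lt.2 (intervalIntegral.integral_nonneg ht fun s _ => hf _ (hTC s u hu)))

lemma tendsto_average [CompleteSpace X] (hT : IsSemigroup T) (u : X) :
    Tendsto (fun t : ℝ => t⁻¹ • ∫ s in (0 : ℝ)..t, T s u) (𝓝[>] 0) (𝓝 u) := by
  have h2 := ((hT.hasDerivAt_integral u 0).hasDerivWithinAt (s := Set.Ioi 0))
  rw [hasDerivWithinAt_iff_tendsto_slope' (by simp), hT.zero_apply] at h2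
  refine h2.congr fun t => ?_
  simp [slope_def_module]

/-- Positive vectors are limits of positive vectors in the domain of the generator. -/
lemma mem_closure_domain [CompleteSpace X] {C : ProperCone ℝ X} (hT : IsSemigroup T)
    (hTC : ∀ t, ∀ u ∈ C, T t u ∈ C) {u : X} (hu : u ∈ C) :
    u ∈ closure {v | v ∈ C ∧ ∃ y, HasGen T v y} := by
  refine mem_closure_of_tendsto (hT.tendsto_average u) ?_
  filter_upwards [self_mem_nhdsWithin] with t ht
  have ht : 0 < t := ht
  refine ⟨C.smul_mem (hT.integral_mem hTC hu ht.le) (by positivity), t⁻¹ • (T t u - u), ?_⟩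
  refine ((hT.hasGen_integral u ht.le).const_smul t⁻¹).congr fun s => ?_
  rw [map_smul, ← smul_sub, smul_comm]

/-- Comparison of semigroups by their generators, on the domain of the smaller one. -/
lemma sub_mem [CompleteSpace X] {C : ProperCone ℝ X} (hU : IsSemigroup U)
    (hV : IsSemigroup V) (hUC : ∀ t, ∀ u ∈ C, U t u ∈ C) (hVC : ∀ t, ∀ u ∈ C, V t u ∈ C)
    (h : ∀ u ∈ C, ∀ y, HasGen U u y → ∃ z, HasGen V u z ∧ z - y ∈ C)
    {u : X} (hu : u ∈ C) (t : ℝ) : V t u - U t u ∈ C := by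
  have hc : IsClosed {v | V t v - U t v ∈ C} :=
    C.isClosed.preimage ((V t).continuous.sub (U t).continuous)
  refine hc.closure_subset_iff.2 ?_ (hU.mem_closure_domain hUC hu)
  rintro v ⟨hv, y, hy⟩
  exact hU.sub_mem_of_hasGen hV hUC hVC h hv hy t

lemma dense_domain [CompleteSpace X] (hT : IsSemigroup T) : Dense {u | ∃ y, HasGen T u y} := by
  intro u
  -- With the whole space as cone, positivity is void.
  refine closure_mono ?_ (hT.mem_closure_domain (C := ⊤) (fun _ _ _ => trivial)
    (u := u) trivial)
  exact fun v hv => hv.2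

/-- A generator determines its semigroup. -/
lemma eq_of_hasGen [CompleteSpace X] (hU : IsSemigroup U) (hV : IsSemigroup V)
    (h : ∀ u y, HasGen U u y → HasGen V u y) : U = V := by
  funext t
  rcases le_or_gt t 0 with ht | ht
  · rw [hU.eq_one t ht, hV.eq_one t ht]
  refine DFunLike.coe_injective (Continuous.ext_on hU.dense_domain (U t).continuous (V t).continuous ?_)
  rintro u ⟨y, hy⟩
  have hc := constant_of_has_deriv_right_zero (f := fun r => V (t - r) (U r u)) (a := 0) (b := t)
    (hU.continuous_comp hV t u).continuousOn (fun s hs => by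
      have h1 := hU.hasGen_apply hy hs.1
      simpa using hU.hasDerivWithinAt_comp hV hs.1 hs.2 h1 (h _ _ h1)) t ⟨ht.le, le_rfl⟩
  simpa [hU.zero_apply, hV.zero_apply] using hc

/-- For a contraction semigroup and `r > 0`, the operator `r - A`, with `A` the generator, is
surjective, with positive solutions if the semigroup is positive. -/
lemma exists_resolvent [CompleteSpace X] {C : ProperCone ℝ X} (hT : IsSemigroup T)
    (hT1 : ∀ t, ‖T t‖ ≤ 1) (hTC : ∀ t, ∀ u ∈ C, T t u ∈ C) {r : ℝ} (hr : 0 < r) (f : X) :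
    ∃ u, HasGen T u (r • u - f) ∧ (f ∈ C → u ∈ C) := by
  -- `W` has generator `A - r` and `‖W 1‖ < 1`. Solving `g - W 1 g = f` and integrating `W s g` over
  -- `[0, 1]` replaces the Laplace integral over `[0, ∞)`: the generator of `W` maps the integral to
  -- `W 1 g - g = -f`.
  set W : ℝ → X →L[ℝ] X := fun t => Real.exp (-(r * max t 0)) • T t with hWdef
  have hWt : ∀ t, W t = Real.exp (-(r * max t 0)) • T t := fun _ => rfl
  have hW : IsSemigroup W := by
    refine ⟨fun t ht => ?_, fun s t hs ht => ?_, fun u => ?_⟩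
    · simp [hWt, max_eq_right ht, hT.eq_one t ht]
    · rw [hWt, hWt, hWt, max_eq_left hs, max_eq_left ht, max_eq_left (by positivity),
        hT.add s t hs ht, smul_mul_smul_comm, ← Real.exp_add]
      ring_nf
    · have := hT.cont u
      simp only [hWt, smul_apply]
      fun_prop
  have hWC : ∀ t, ∀ u ∈ C, W t u ∈ C := fun t u hu =>
    C.smul_mem (hTC t u hu) (Real.exp_pos _).le
  have hW1 : ‖W 1‖ < 1 := by
    rw [hWt, norm_smul, Real.norm_of_nonneg (Real.exp_pos _).le]
    calc _ ≤ Real.exp (-(r * max 1 0)) * 1 := by gcongr; exact hT1 1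
      _ < 1 := by simpa using hr
  obtain ⟨g, hgf, hgC⟩ := exists_sub_apply_eq hW1 (hWC 1) f
  refine ⟨∫ s in (0 : ℝ)..1, W s g, ?_, fun hf => hW.integral_mem hWC (hgC hf) zero_le_one⟩
  set u := ∫ s in (0 : ℝ)..1, W s g with hu
  have h1 : HasGen W u (-f) := by
    have := hW.hasGen_integral g (t := 1) zero_le_one
    rwa [← neg_sub, hgf] at this
  -- The rescaling is undone by the product rule for `T t u = exp (r * t) • W t u`.
  have h2 : Tendsto (fun t : ℝ => t⁻¹ * (Real.exp (r * t) - 1)) (𝓝[>] 0) (𝓝 r) := by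
    have h := ((hasDerivAt_id (0 : ℝ)).const_mul r).exp.hasDerivWithinAt (s := Set.Ioi 0)
    rw [hasDerivWithinAt_iff_tendsto_slope' (by simp)] at h
    simp only [id, mul_zero, Real.exp_zero, one_mul, mul_one] at h
    refine h.congr fun t => ?_
    simp [slope_def_field, div_eq_inv_mul]
  have h3 : Tendsto (fun t : ℝ => Real.exp (r * t)) (𝓝[>] 0) (𝓝 1) := by
    have : Continuous fun t : ℝ => Real.exp (r * t) := by fun_prop
    simpa using (this.tendsto 0).mono_left nhdsWithin_le_nhds
  have h4 := (h2.smul_const u).add (h3.smul h1)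
  rw [one_smul, ← sub_eq_add_neg] at h4
  refine h4.congr' ?_
  filter_upwards [self_mem_nhdsWithin] with t ht
  have ht : 0 < t := ht
  have e : T t u = Real.exp (r * t) • W t u := by
    rw [hWt, max_eq_left ht.le, smul_apply, smul_smul, ← Real.exp_add]
    simp
  rw [e, mul_smul, smul_comm (Real.exp _), ← smul_add]
  congr 1
  rw [sub_smul, smul_sub, one_smul]
  abel

end IsSemigroup

end Semigroups
-- Strong limits of contraction semigroups.
section Limits

variable {X : Type*} [NormedAddCommGroup X] [NormedSpace ℝ X]

lemma tendsto_of_dense {ι : Type*} {l : Filter ι} {B : ι → X →L[ℝ] X} {M : ℝ} (hB : ∀ i, ‖B i‖ ≤ M)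
    {s : Set X} (hs : Dense s) (h : ∀ u ∈ s, Tendsto (fun i => B i u) l (𝓝 0)) (v : X) :
    Tendsto (fun i => B i v) l (𝓝 0) := by
  rw [NormedAddGroup.tendsto_nhds_zero]
  intro ε hε
  set L := max M 1 with hL
  have hL1 : 0 < L := lt_of_lt_of_le one_pos (le_max_right _ _)
  obtain ⟨u, hu, hvu⟩ := Metric.dense_iff.1 hs v (ε / 2 / L) (by positivity)
  rw [Metric.mem_ball', dist_eq_norm] at hu
  filter_upwards [NormedAddGroup.tendsto_nhds_zero.1 (h u hvu) (ε / 2) (by positivity)]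
    with i hi
  have h1 : ‖B i (v - u)‖ < ε / 2 := by
    refine ((B i).le_of_opNorm_le ((hB i).trans (le_max_left _ 1)) _).trans_lt ?_
    rw [lt_div_iff₀ hL1] at hu
    linarith
  rw [map_sub] at h1
  calc ‖B i v‖ = ‖(B i v - B i u) + B i u‖ := by rw [sub_add_cancel]
    _ < ε / 2 + ε / 2 := (norm_add_le _ _).trans_lt (add_lt_add h1 hi)
    _ = ε := by ring

/-- Strong limits of contraction semigroups with a uniform modulus of continuity at zero, and of
their generators. -/
theorem exists_limit_semigroup [CompleteSpace X] {ι : Type*} {l : Filter ι} [NeBot l]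
    {S : ι → ℝ → X →L[ℝ] X} (hS : ∀ i, IsSemigroup (S i)) (hS1 : ∀ i t, ‖S i t‖ ≤ 1)
    (hmod : ∀ v, ∀ ε > 0, ∃ δ > 0, ∀ i s, 0 ≤ s → s < δ → ‖S i s v - v‖ ≤ ε)
    (hlim : ∀ t v, ∃ w, Tendsto (fun i => S i t v) l (𝓝 w)) :
    ∃ T : ℝ → X →L[ℝ] X, IsSemigroup T ∧ (∀ t, ‖T t‖ ≤ 1) ∧
      (∀ t v, Tendsto (fun i => S i t v) l (𝓝 (T t v))) ∧
      ∀ (u y : X) (g : ι → X), (∀ i, HasGen (S i) u (g i)) → Tendsto g l (𝓝 y) → HasGen T u y := by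
  choose F hF using hlim
  let T : ℝ → X →L[ℝ] X := fun t => LinearMap.mkContinuous
    { toFun := F t
      map_add' := fun u v => tendsto_nhds_unique (hF t (u + v)) (by
        simpa using (hF t u).add (hF t v))
      map_smul' := fun c u => tendsto_nhds_unique (hF t (c • u)) (by
        simpa using (hF t u).const_smul c) } 1
    (fun u => le_of_tendsto (hF t u).norm (Eventually.of_forall fun i =>
      (S i t).le_of_opNorm_le (hS1 i t) u))
  have hT1 : ∀ t, ‖T t‖ ≤ 1 := fun t => LinearMap.mkContinuous_norm_le _ zero_le_one _
  have hT : ∀ t v, Tendsto (fun i => S i t v) l (𝓝 (T t v)) := hF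
  have hT0 : ∀ v, Tendsto (fun t => T t v) (𝓝[>] 0) (𝓝 v) := by
    intro v
    rw [Metric.tendsto_nhds]
    intro ε hε
    obtain ⟨δ, hδ, h⟩ := hmod v (ε / 2) (by positivity)
    filter_upwards [self_mem_nhdsWithin, nhdsWithin_le_nhds (Iio_mem_nhds hδ)] with t ht0 htδ
    rw [dist_eq_norm]
    refine lt_of_le_of_lt ?_ (half_lt_self hε)
    exact le_of_tendsto ((hT t v).sub_const v).norm
      (Eventually.of_forall fun i => h i t (le_of_lt ht0) htδ)
  have hC0 : IsC0Semigroup T := by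
    refine ⟨fun s t hs ht => ?_, hT0⟩
    ext v
    refine tendsto_nhds_unique (hT (s + t) v) ?_
    have h1 : Tendsto (fun i => S i s (S i t v - T t v)) l (𝓝 0) := by
      refine squeeze_zero_norm (a := fun i => ‖S i t v - T t v‖) (fun i => ?_) ?_
      · simpa using (S i s).le_of_opNorm_le (hS1 i s) (S i t v - T t v)
      · simpa using ((hT t v).sub_const (T t v)).norm
    have h2 := h1.add (hT s (T t v))
    rw [zero_add] at h2
    refine h2.congr fun i => ?_
    rw [map_sub, sub_add_cancel, (hS i).add_apply hs.le ht.le]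
  have hT' : IsSemigroup T := by
    have h := hC0.isSemigroup_extendOne
    have e : extendOne T = T := by
      funext t
      by_cases ht : 0 < t
      · exact extendOne_of_pos T ht
      · ext v
        rw [h.eq_one t (not_lt.1 ht)]
        refine tendsto_nhds_unique ?_ (hT t v)
        simp [fun i => (hS i).eq_one t (not_lt.1 ht)]
    rwa [e] at h
  refine ⟨T, hT', hT1, hT, fun u y g hg hgy => ?_⟩
  rw [HasGen, Metric.tendsto_nhds]
  intro ε hε
  obtain ⟨δ, hδ, h⟩ := hmod y (ε / 4) (by positivity)
  filter_upwards [self_mem_nhdsWithin, nhdsWithin_le_nhds (Iio_mem_nhds hδ)] with t ht0 htδ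
  have ht0 : 0 < t := ht0
  -- One `ε / 4` comes from the modulus at `y`, the other two from replacing `g i` by `y` before and
  -- after applying `S i s`.
  have key : ‖T t u - u - t • y‖ ≤ (3 * (ε / 4)) * t := by
    refine le_of_tendsto (((hT t u).sub_const u).sub (hgy.const_smul t)).norm ?_
    have hgy' : ∀ᶠ i in l, ‖g i - y‖ < ε / 4 := by
      simpa [dist_eq_norm] using Metric.tendsto_nhds.1 hgy (ε / 4) (by positivity)
    filter_upwards [hgy'] with i hi
    refine (hS i).norm_sub_sub_smul_le (hg i) ht0.le fun s hs0 hst => ?_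
    have e : S i s (g i) - g i = S i s (g i - y) + (S i s y - y) - (g i - y) := by
      rw [map_sub]; abel
    have h1 : ‖S i s (g i - y)‖ ≤ ‖g i - y‖ := by
      simpa using (S i s).le_of_opNorm_le (hS1 i s) (g i - y)
    have h2 := h i s hs0 (hst.trans htδ)
    rw [e]
    have h3 := norm_sub_le (S i s (g i - y) + (S i s y - y)) (g i - y)
    have h4 := norm_add_le (S i s (g i - y)) (S i s y - y)
    linarith
  have e : t⁻¹ • (T t u - u) - y = t⁻¹ • (T t u - u - t • y) := by
    rw [smul_sub t⁻¹ _ (t • y), inv_smul_smul₀ ht0.ne']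
  rw [dist_eq_norm, e, norm_smul, Real.norm_of_nonneg (by positivity)]
  calc t⁻¹ * ‖T t u - u - t • y‖ ≤ t⁻¹ * ((3 * (ε / 4)) * t) := by gcongr
    _ = 3 * (ε / 4) := by field_simp
    _ < ε := by linarith

end Limits

/-! ### Semigroups of bounded generators. -/

section Exponential

variable {X : Type*} [NormedAddCommGroup X] [NormedSpace ℝ X]

/-- The semigroup generated by a bounded operator. -/
noncomputable def expSemigroup (Y : X →L[ℝ] X) (t : ℝ) : X →L[ℝ] X :=
  NormedSpace.exp ((max t 0) • Y)

lemma expSemigroup_commute {Y Z : X →L[ℝ] X} (h : Commute Y Z) (t : ℝ) :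
    Commute Y (expSemigroup Z t) :=
  (h.smul_right (max t 0)).exp_right

variable [CompleteSpace X]

lemma exp_add_clm {P Q : X →L[ℝ] X} (h : Commute P Q) :
    NormedSpace.exp (P + Q) = NormedSpace.exp P * NormedSpace.exp Q :=
  letI := NormedAlgebra.restrictScalars ℚ ℝ (X →L[ℝ] X)
  NormedSpace.exp_add_of_commute h

lemma norm_exp_le (P : X →L[ℝ] X) : ‖NormedSpace.exp P‖ ≤ Real.exp ‖P‖ := by
  have h1 := NormedSpace.exp_series_hasSum_exp' (𝕂 := ℝ) P
  have h2 := NormedSpace.exp_series_hasSum_exp' (𝕂 := ℝ) ‖P‖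
  rw [← Real.exp_eq_exp_ℝ] at h2
  refine h1.norm_le_of_bounded h2 fun n => ?_
  rw [norm_smul, Real.norm_of_nonneg (by positivity), smul_eq_mul]
  gcongr
  rcases n.eq_zero_or_pos with rfl | hn
  · simpa using! ContinuousLinearMap.norm_id_le
  · exact norm_pow_le' P hn

lemma expSemigroup_hasGen (Y : X →L[ℝ] X) (u : X) : HasGen (expSemigroup Y) u (Y u) := by
  have h := (hasDerivAt_exp_smul_const (𝕂 := ℝ) Y (0 : ℝ)).hasDerivWithinAt (s := Set.Ioi 0)
  rw [hasDerivWithinAt_iff_tendsto_slope' (by simp)] at h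
  simp only [zero_smul, NormedSpace.exp_zero, one_mul] at h
  have h2 := ((ContinuousLinearMap.apply ℝ X u).continuous.tendsto Y).comp h
  refine h2.congr' ?_
  filter_upwards [self_mem_nhdsWithin] with t ht
  have ht : 0 < t := ht
  simp [slope_def_module, expSemigroup, max_eq_left ht.le]

lemma isSemigroup_expSemigroup (Y : X →L[ℝ] X) : IsSemigroup (expSemigroup Y) where
  eq_one t ht := by simp [expSemigroup, max_eq_right ht]
  add s t hs ht := by
    rw [expSemigroup, expSemigroup, expSemigroup, max_eq_left hs, max_eq_left ht,
      max_eq_left (by positivity), add_smul]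
    exact exp_add_clm (((Commute.refl Y).smul_left s).smul_right t)
  cont u := by
    have h : Continuous fun t : ℝ => NormedSpace.exp (t • Y) :=
      continuous_iff_continuousAt.2 fun t =>
        (hasDerivAt_exp_smul_const (𝕂 := ℝ) Y t).continuousAt
    exact (h.comp (continuous_id.max continuous_const)).clm_apply continuous_const

/-- For `a ≥ 0` the right side is a power series in `P` with nonnegative coefficients of total mass
one, so positivity and contractivity of `P` pass to the semigroup. -/
lemma expSemigroup_eq (a : ℝ) (P : X →L[ℝ] X) (t : ℝ) :
    expSemigroup (a • (P - 1)) t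
      = Real.exp (-(max t 0 * a)) • NormedSpace.exp ((max t 0 * a) • P) := by
  have e : (max t 0) • (a • (P - 1)) = (max t 0 * a) • P + (-(max t 0 * a)) • (1 : X →L[ℝ] X) := by
    rw [smul_smul, smul_sub, neg_smul, sub_eq_add_neg]
  have e2 : NormedSpace.exp ((-(max t 0 * a)) • (1 : X →L[ℝ] X))
      = Real.exp (-(max t 0 * a)) • 1 := by
    rw [Real.exp_eq_exp_ℝ, ← Algebra.algebraMap_eq_smul_one, ← Algebra.algebraMap_eq_smul_one,
      NormedSpace.algebraMap_exp_comm]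
  rw [expSemigroup, e, exp_add_clm ((Commute.one_right _).smul_right _), e2, mul_smul_comm, mul_one]

lemma norm_expSemigroup_le {a : ℝ} (ha : 0 ≤ a) {P : X →L[ℝ] X} (hP : ‖P‖ ≤ 1) (t : ℝ) :
    ‖expSemigroup (a • (P - 1)) t‖ ≤ 1 := by
  have h0 : 0 ≤ max t 0 * a := mul_nonneg (le_max_right _ _) ha
  rw [expSemigroup_eq, norm_smul, Real.norm_of_nonneg (Real.exp_pos _).le]
  calc _ ≤ Real.exp (-(max t 0 * a)) * Real.exp (max t 0 * a) := by
        gcongr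
        refine (norm_exp_le _).trans (Real.exp_le_exp.2 ?_)
        rw [norm_smul, Real.norm_of_nonneg h0]
        exact mul_le_of_le_one_right h0 hP
    _ = 1 := by rw [← Real.exp_add]; simp

lemma expSemigroup_mem {C : ProperCone ℝ X} {a : ℝ} (ha : 0 ≤ a) {P : X →L[ℝ] X}
    (hP : ∀ u ∈ C, P u ∈ C) (t : ℝ) {u : X} (hu : u ∈ C) :
    expSemigroup (a • (P - 1)) t u ∈ C := by
  have h0 : 0 ≤ max t 0 * a := mul_nonneg (le_max_right _ _) ha
  rw [expSemigroup_eq]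
  refine C.smul_mem ?_ (Real.exp_pos _).le
  have h1 := (NormedSpace.exp_series_hasSum_exp' (𝕂 := ℝ) ((max t 0 * a) • P)).mapL
    (ContinuousLinearMap.apply ℝ X u)
  refine C.isClosed.mem_of_tendsto h1 (Eventually.of_forall fun s => sum_mem fun n _ => ?_)
  have h2 : ∀ n : ℕ, (((max t 0 * a) • P) ^ n) u ∈ C := fun n => by
    induction n with
    | zero => simpa using hu
    | succ n ih => rw [pow_succ']; exact C.smul_mem (hP _ ih) h0
  exact C.smul_mem (h2 n) (by positivity)

/-- Along `r ↦ exp ((t - r) Z) exp (r Y) u` commutation moves `Y - Z` next to `u`, leaving only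
contractions in front of `Y u - Z u`. -/
lemma norm_expSemigroup_sub_le {Y Z : X →L[ℝ] X} (h : Commute Y Z)
    (hY : ∀ t, ‖expSemigroup Y t‖ ≤ 1) (hZ : ∀ t, ‖expSemigroup Z t‖ ≤ 1) {t : ℝ} (ht : 0 ≤ t)
    (u : X) : ‖expSemigroup Y t u - expSemigroup Z t u‖ ≤ ‖Y u - Z u‖ * t := by
  have hYs := isSemigroup_expSemigroup Y
  have hZs := isSemigroup_expSemigroup Z
  have := norm_image_sub_le_of_norm_deriv_right_le_segment
    (f := fun r => expSemigroup Z (t - r) (expSemigroup Y r u))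
    (f' := fun s => expSemigroup Z (t - s) (Y (expSemigroup Y s u) - Z (expSemigroup Y s u)))
    (a := 0) (b := t) (C := ‖Y u - Z u‖) (hYs.continuous_comp hZs t u).continuousOn
    (fun s hs => hYs.hasDerivWithinAt_comp hZs hs.1 hs.2 (expSemigroup_hasGen Y _)
      (expSemigroup_hasGen Z _))
    (fun s hs => by
      have e1 : Y (expSemigroup Y s u) = expSemigroup Y s (Y u) :=
        congrArg (fun A : X →L[ℝ] X => A u) (expSemigroup_commute (Commute.refl Y) s)
      have e2 : Z (expSemigroup Y s u) = expSemigroup Y s (Z u) :=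
        congrArg (fun A : X →L[ℝ] X => A u) (expSemigroup_commute h.symm s)
      rw [e1, e2, ← map_sub]
      refine ((expSemigroup Z (t - s)).le_of_opNorm_le (hZ _) _).trans ?_
      rw [one_mul]
      simpa using (expSemigroup Y s).le_of_opNorm_le (hY s) (Y u - Z u))
    t ⟨ht, le_rfl⟩
  simpa [hYs.zero_apply, hZs.zero_apply] using this

lemma norm_expSemigroup_sub_self_le {Y : X →L[ℝ] X} (hY : ∀ t, ‖expSemigroup Y t‖ ≤ 1) {t : ℝ}
    (ht : 0 ≤ t) (u : X) : ‖expSemigroup Y t u - u‖ ≤ ‖Y u‖ * t := by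
  have h0 : ∀ t, expSemigroup (0 : X →L[ℝ] X) t = 1 := fun t => by simp [expSemigroup]
  simpa [h0] using norm_expSemigroup_sub_le (Commute.zero_right Y) hY
    (fun t => by rw [h0]; exact ContinuousLinearMap.norm_id_le) ht u

end Exponential

/-! ### Hille–Yosida theorem with a preserved cone, by Yosida approximation. -/

section HilleYosida

variable {X : Type*} [NormedAddCommGroup X] [NormedSpace ℝ X]

/-- The resolvent as a bounded operator. -/
lemma exists_resolvent_operator {C : ProperCone ℝ X} {D : Submodule ℝ X} (A : D →ₗ[ℝ] X) {r : ℝ}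
    (hr : 0 < r) (hdiss : ∀ u : D, r * ‖(u : X)‖ ≤ ‖r • (u : X) - A u‖)
    (hsurj : ∀ f, ∃ u : D, r • (u : X) - A u = f ∧ (f ∈ C → (u : X) ∈ C)) :
    ∃ R : X →L[ℝ] X, (∀ f, ∃ u : D, (u : X) = R f ∧ r • (u : X) - A u = f) ∧
      (∀ u : D, R (r • (u : X) - A u) = u) ∧ ‖r • R‖ ≤ 1 ∧ ∀ f ∈ C, R f ∈ C := by
  let L : D →ₗ[ℝ] X := r • D.subtype - A
  have hL : ∀ u, L u = r • (u : X) - A u := fun u => rfl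
  have hinj : Function.Injective L := by
    refine (injective_iff_map_eq_zero L).2 fun u hu => ?_
    have := hdiss u
    rw [← hL, hu, norm_zero] at this
    have h0 : ‖(u : X)‖ ≤ 0 := by
      by_contra hn; push Not at hn; nlinarith
    simpa using h0
  have hsur : Function.Surjective L := fun f => (hsurj f).imp fun u hu => hu.1
  let e := LinearEquiv.ofBijective L ⟨hinj, hsur⟩
  have he : ∀ u, e u = L u := fun u => rfl
  have hes : ∀ f, r • (e.symm f : X) - A (e.symm f) = f := fun f => by
    rw [← hL, ← he, LinearEquiv.apply_symm_apply]
  have hbound : ∀ f, ‖(D.subtype ∘ₗ e.symm.toLinearMap) f‖ ≤ r⁻¹ * ‖f‖ := by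
    intro f
    have := hdiss (e.symm f)
    rw [hes] at this
    rw [inv_mul_eq_div, le_div_iff₀ hr, mul_comm]
    exact this
  refine ⟨LinearMap.mkContinuous _ r⁻¹ hbound, fun f => ⟨e.symm f, rfl, hes f⟩, fun u => ?_, ?_, ?_⟩
  · rw [← hL, ← he]
    simp
  · rw [norm_smul, Real.norm_of_nonneg hr.le]
    calc _ ≤ r * r⁻¹ := by
          gcongr; exact LinearMap.mkContinuous_norm_le _ (by positivity) _
      _ = 1 := mul_inv_cancel₀ hr.ne'
  · intro f hf
    obtain ⟨u, hu, huC⟩ := hsurj f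
    have : e.symm f = u := by rw [LinearEquiv.symm_apply_eq, he, hL, hu]
    change (e.symm f : X) ∈ C
    rw [this]
    exact huC hf

/-- **Hille–Yosida theorem** for contraction semigroups that preserve a closed cone. -/
theorem exists_semigroup_of_resolvent [CompleteSpace X] {C : ProperCone ℝ X} {D : Submodule ℝ X}
    (A : D →ₗ[ℝ] X) (hD : Dense (D : Set X)) {r₀ : ℝ} (hr₀ : 0 ≤ r₀)
    (hdiss : ∀ r, r₀ < r → ∀ u : D, r * ‖(u : X)‖ ≤ ‖r • (u : X) - A u‖)
    (hsurj : ∀ r, r₀ < r → ∀ f, ∃ u : D, r • (u : X) - A u = f ∧ (f ∈ C → (u : X) ∈ C)) :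
    ∃ T : ℝ → X →L[ℝ] X, IsSemigroup T ∧ (∀ t, ‖T t‖ ≤ 1) ∧ (∀ t, ∀ u ∈ C, T t u ∈ C) ∧
      ∀ u y, HasGen T u y ↔ ∃ v : D, (v : X) = u ∧ A v = y := by
  -- The shift by one keeps `ρ n` strictly above `r₀`, hence positive; `ρ` is injective, as the
  -- commutation of resolvents uses.
  set ρ : ℕ → ℝ := fun n => r₀ + (n + 1) with hρ
  have hρ1 : ∀ n, r₀ < ρ n := fun n => by simp only [hρ]; linarith [n.cast_nonneg (α := ℝ)]
  have hρ0 : ∀ n, 0 < ρ n := fun n => hr₀.trans_lt (hρ1 n)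
  have hρlim : Tendsto ρ atTop atTop :=
    tendsto_atTop_add_const_left _ _
      (tendsto_atTop_add_const_right _ _ tendsto_natCast_atTop_atTop)
  choose R hR1 hR2 hR3 hR4 using fun n => exists_resolvent_operator (C := C) A (hρ0 n)
    (hdiss _ (hρ1 n)) (hsurj _ (hρ1 n))
  -- Yosida approximation: on `D` it equals `ρ n • R n A`, which is bounded by `‖A u‖` and tends to
  -- `A u`.
  set Y : ℕ → X →L[ℝ] X := fun n => ρ n • (ρ n • R n - 1) with hY
  have hRA : ∀ n (u : D), ρ n • R n u - u = R n (A u) := by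
    intro n u
    have := hR2 n u
    rw [map_sub, map_smul] at this
    rw [sub_eq_iff_eq_add] at this ⊢
    rw [this, add_comm]
  have hYA : ∀ n (u : D), Y n u = ρ n • R n (A u) := fun n u => by
    simp only [hY, smul_apply, sub_apply, ← hRA]; rfl
  have hYle : ∀ n (u : D), ‖Y n u‖ ≤ ‖A u‖ := fun n u => by
    rw [hYA]
    simpa using (ρ n • R n).le_of_opNorm_le (hR3 n) (A u)
  have hE1 : ∀ n t, ‖expSemigroup (Y n) t‖ ≤ 1 := fun n => norm_expSemigroup_le (hρ0 n).le (hR3 n)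
  have hcomm : ∀ n m, Commute (R n) (R m) := by
    intro n m
    -- Resolvent identity; comparing it with its copy for `n` and `m` exchanged gives commutation.
    have key : ∀ n m f, R m f = R n f + (ρ n - ρ m) • R m (R n f) := by
      intro n m f
      obtain ⟨a, ha, haf⟩ := hR1 n f
      have h2 := hR2 m a
      have e : f = (ρ m • (a : X) - A a) + (ρ n - ρ m) • (a : X) := by
        rw [← haf, sub_smul]; abel
      rw [← ha]
      conv_lhs => rw [e, map_add, h2, map_smul]
    ext f
    have h1 := key n m f
    have h2 := key m n f
    by_cases hnm : ρ n = ρ m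
    · have e : n = m := by simpa [hρ] using hnm
      rw [e]
    · have h3 : (ρ n - ρ m) • (R m (R n f) - R n (R m f)) = 0 := by
        rw [smul_sub, ← sub_eq_iff_eq_add'.2 h1, ← neg_sub (ρ m), neg_smul,
          ← sub_eq_iff_eq_add'.2 h2]
        abel
      exact (sub_eq_zero.1 ((smul_eq_zero.1 h3).resolve_left (sub_ne_zero.2 hnm))).symm
  have hYcomm : ∀ n m, Commute (Y n) (Y m) := fun n m =>
    ((((((hcomm n m).smul_left _).smul_right _).sub_left (Commute.one_left _)).sub_right
      (Commute.one_right _)).smul_left _).smul_right _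
  have hρR : ∀ v, Tendsto (fun n => (ρ n • R n) v) atTop (𝓝 v) := by
    intro v
    have h1 : Tendsto (fun n => (ρ n • R n - 1) v) atTop (𝓝 0) := by
      refine tendsto_of_dense (M := 2) (fun n => ?_) hD (fun u hu => ?_) v
      · refine (norm_sub_le _ _).trans ?_
        have : ‖(1 : X →L[ℝ] X)‖ ≤ 1 := ContinuousLinearMap.norm_id_le
        linarith [hR3 n]
      · lift u to D using hu
        have h2 : Tendsto (fun n => (ρ n)⁻¹ * ‖A u‖) atTop (𝓝 0) := by
          simpa using hρlim.inv_tendsto_atTop.mul_const ‖A u‖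
        refine squeeze_zero_norm (fun n => ?_) h2
        have e : (ρ n • R n - 1) (u : X) = R n (A u) := hRA n u
        rw [e, le_inv_mul_iff₀ (hρ0 n)]
        have h3 := (ρ n • R n).le_of_opNorm_le (hR3 n) (A u)
        rwa [smul_apply, norm_smul, Real.norm_of_nonneg (hρ0 n).le, one_mul] at h3
    simpa using h1.add_const v
  have hYlim : ∀ u : D, Tendsto (fun n => Y n u) atTop (𝓝 (A u)) := fun u => by
    simp only [hYA]
    exact hρR (A u)
  obtain ⟨T, hT, hT1, hTlim, hTgen⟩ := exists_limit_semigroup (l := atTop)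
    (S := fun n => expSemigroup (Y n)) (fun n => isSemigroup_expSemigroup _) hE1
    (by
      intro v ε hε
      obtain ⟨w, hw, hwD⟩ := Metric.dense_iff.1 hD v (ε / 4) (by positivity)
      lift w to D using hwD
      rw [Metric.mem_ball', dist_eq_norm] at hw
      refine ⟨ε / (2 * (‖A w‖ + 1)), by positivity, fun n s hs hsδ => ?_⟩
      have h1 : ‖expSemigroup (Y n) s (w : X) - w‖ ≤ ε / 2 := by
        refine (norm_expSemigroup_sub_self_le (hE1 n) hs _).trans ?_
        rw [lt_div_iff₀ (by positivity)] at hsδ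
        have := mul_le_mul_of_nonneg_right (hYle n w) hs
        nlinarith [norm_nonneg (A w)]
      have h2 : ‖expSemigroup (Y n) s (v - w)‖ ≤ ‖v - w‖ := by
        simpa using (expSemigroup (Y n) s).le_of_opNorm_le (hE1 n s) (v - w)
      have e : expSemigroup (Y n) s v - v = expSemigroup (Y n) s (v - w)
          + (expSemigroup (Y n) s (w : X) - w) - (v - w) := by rw [map_sub]; abel
      rw [e]
      have h3 := norm_sub_le (expSemigroup (Y n) s (v - w)
          + (expSemigroup (Y n) s (w : X) - w)) (v - w)
      have h4 := norm_add_le (expSemigroup (Y n) s (v - w)) (expSemigroup (Y n) s (w : X) - w)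
      linarith)
    (by
      intro t v
      rcases le_or_gt t 0 with ht | ht
      · exact ⟨v, by simp [fun n => (isSemigroup_expSemigroup (Y n)).eq_one t ht]⟩
      refine cauchySeq_tendsto_of_complete ?_
      rw [Metric.cauchySeq_iff']
      intro ε hε
      obtain ⟨w, hw, hwD⟩ := Metric.dense_iff.1 hD v (ε / 4) (by positivity)
      lift w to D using hwD
      rw [Metric.mem_ball', dist_eq_norm] at hw
      obtain ⟨N, hN⟩ := Metric.cauchySeq_iff'.1 (hYlim w).cauchySeq (ε / 2 / t) (by positivity)
      refine ⟨N, fun n hn => ?_⟩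
      have h1 : ‖expSemigroup (Y n) t (w : X) - expSemigroup (Y N) t w‖ < ε / 2 := by
        refine (norm_expSemigroup_sub_le (hYcomm n N) (hE1 n) (hE1 N) ht.le _).trans_lt ?_
        rw [← lt_div_iff₀ ht, ← dist_eq_norm]
        exact hN n hn
      have h2 : ∀ n, ‖expSemigroup (Y n) t (v - w)‖ ≤ ‖v - w‖ := fun n => by
        simpa using (expSemigroup (Y n) t).le_of_opNorm_le (hE1 n t) (v - w)
      have e : expSemigroup (Y n) t v - expSemigroup (Y N) t v = expSemigroup (Y n) t (v - w)
          + (expSemigroup (Y n) t (w : X) - expSemigroup (Y N) t w)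
          - expSemigroup (Y N) t (v - w) := by rw [map_sub, map_sub]; abel
      rw [dist_eq_norm, e]
      have h3 := norm_sub_le (expSemigroup (Y n) t (v - w)
          + (expSemigroup (Y n) t (w : X) - expSemigroup (Y N) t w))
          (expSemigroup (Y N) t (v - w))
      have h4 := norm_add_le (expSemigroup (Y n) t (v - w))
        (expSemigroup (Y n) t (w : X) - expSemigroup (Y N) t w)
      linarith [h2 n, h2 N])
  have hgen : ∀ v : D, HasGen T v (A v) := fun v =>
    hTgen v (A v) (fun n => Y n v) (fun n => expSemigroup_hasGen _ _) (hYlim v)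
  refine ⟨T, hT, hT1, fun t u hu => ?_, fun u y => ⟨fun h => ?_, ?_⟩⟩
  · exact C.isClosed.mem_of_tendsto (hTlim t u) (Eventually.of_forall fun n =>
      expSemigroup_mem (hρ0 n).le
        (fun f hf => C.smul_mem (hR4 n f hf) (hρ0 n).le) t hu)
  -- The generator of `T` is no larger than `A`: `ρ 0 - A` is already onto, and dissipativity makes
  -- `ρ 0` minus the generator injective, so `u` equals the solution `v` found in `D`.
  · obtain ⟨v, hv, -⟩ := hsurj (ρ 0) (hρ1 0) (ρ 0 • u - y)
    have h1 : HasGen T (u - v) (y - A v) := by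
      refine (h.sub (hgen v)).congr fun t => ?_
      rw [← smul_sub, map_sub]
      congr 1
      abel
    have h2 := IsSemigroup.norm_le_of_hasGen hT1 h1 (ρ 0)
    have e : ρ 0 • (u - v) - (y - A v) = 0 := by
      rw [smul_sub, sub_sub_sub_comm, hv, sub_self]
    rw [e, norm_zero] at h2
    have h3 : ‖u - v‖ ≤ 0 := by
      by_contra hn; push Not at hn; nlinarith [hρ0 0]
    have h4 : (v : X) = u := (sub_eq_zero.1 (norm_le_zero_iff.1 h3)).symm
    refine ⟨v, h4, ?_⟩
    rw [h4] at hv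
    exact sub_right_injective hv
  · rintro ⟨v, rfl, rfl⟩
    exact hgen v

end HilleYosida

/-! ### Positive perturbations when the norm is additive on a generating cone. -/

section AdditiveNorm

variable {X : Type*} [NormedAddCommGroup X] [NormedSpace ℝ X]

/-- `C` is a generating cone on which the norm is given by the linear functional `tr`. -/
structure IsAdditiveNorm (C : ProperCone ℝ X) (tr : X →ₗ[ℝ] ℝ) : Prop where
  norm_eq : ∀ u ∈ C, ‖u‖ = tr u
  decomp : ∀ u, ∃ a ∈ C, ∃ b ∈ C, u = a - b ∧ ‖u‖ = ‖a‖ + ‖b‖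

/-- A strongly continuous contraction semigroup that preserves the cone `C`. -/
structure IsPosSemigroup (C : ProperCone ℝ X) (T : ℝ → X →L[ℝ] X) : Prop extends
    IsSemigroup T where
  norm_le_one : ∀ t, ‖T t‖ ≤ 1
  mem : ∀ t, ∀ u ∈ C, T t u ∈ C

/-- The operator `A` with domain `D` is the generator of `T`. -/
def GeneratedBy {D : Submodule ℝ X} (T : ℝ → X →L[ℝ] X) (A : D →ₗ[ℝ] X) : Prop :=
  ∀ u y, HasGen T u y ↔ ∃ v : D, (v : X) = u ∧ A v = y

lemma GeneratedBy.hasGen {D : Submodule ℝ X} {T : ℝ → X →L[ℝ] X} {A : D →ₗ[ℝ] X}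
    (h : GeneratedBy T A) (u : D) : HasGen T u (A u) :=
  (h _ _).2 ⟨u, rfl, rfl⟩

namespace IsAdditiveNorm

variable {C : ProperCone ℝ X} {tr : X →ₗ[ℝ] ℝ}

lemma tr_le (hC : IsAdditiveNorm C tr) (u : X) : tr u ≤ ‖u‖ := by
  obtain ⟨a, ha, b, hb, rfl, h⟩ := hC.decomp u
  rw [h, map_sub, ← hC.norm_eq a ha, ← hC.norm_eq b hb]
  linarith [norm_nonneg b]

lemma tr_nonneg (hC : IsAdditiveNorm C tr) {u : X} (hu : u ∈ C) : 0 ≤ tr u := by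
  rw [← hC.norm_eq u hu]; exact norm_nonneg u

lemma eq_zero (hC : IsAdditiveNorm C tr) {u : X} (hu : u ∈ C) (hu' : -u ∈ C) : u = 0 := by
  have h1 := hC.norm_eq u hu
  have h2 := hC.norm_eq _ hu'
  rw [norm_neg, map_neg] at h2
  have := norm_nonneg u
  exact norm_le_zero_iff.1 (by linarith)

/-- The norms in the decomposition add up exactly, so no constant is lost. This keeps the
perturbation a strict contraction. -/
lemma norm_le (hC : IsAdditiveNorm C tr) {L : X →ₗ[ℝ] X} {M : ℝ}
    (h : ∀ u ∈ C, ‖L u‖ ≤ M * ‖u‖) (u : X) : ‖L u‖ ≤ M * ‖u‖ := by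
  obtain ⟨a, ha, b, hb, rfl, he⟩ := hC.decomp u
  rw [he, map_sub, mul_add]
  exact (norm_sub_le _ _).trans (add_le_add (h a ha) (h b hb))

/-- Increasing nets that are bounded in norm converge. -/
lemma exists_tendsto [CompleteSpace X] (hC : IsAdditiveNorm C tr) {J : Type*} [Preorder J]
    [IsDirectedOrder J] [Nonempty J] {f : J → X} (hf : ∀ α β, α ≤ β → f β - f α ∈ C) {M : ℝ}
    (hM : ∀ α, tr (f α) ≤ M) : ∃ y, Tendsto f atTop (𝓝 y) := by
  refine cauchy_map_iff_exists_tendsto.1 (Metric.cauchy_iff.2 ⟨inferInstance, fun ε hε => ?_⟩)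
  have hbdd : BddAbove (Set.range fun α => tr (f α)) := ⟨M, by rintro _ ⟨α, rfl⟩; exact hM α⟩
  -- Beyond an index whose trace is nearly the supremum, distances are differences of traces.
  obtain ⟨α, hα⟩ := exists_lt_of_lt_ciSup (f := fun α => tr (f α))
    (sub_lt_self (⨆ α, tr (f α)) (half_pos hε))
  have key : ∀ β, α ≤ β → dist (f β) (f α) < ε / 2 := fun β hβ => by
    rw [dist_eq_norm, hC.norm_eq _ (hf α β hβ), map_sub]
    linarith [le_ciSup hbdd β]
  refine ⟨f '' Set.Ici α, image_mem_map (Ici_mem_atTop α), ?_⟩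
  rintro _ ⟨β, hβ, rfl⟩ _ ⟨γ, hγ, rfl⟩
  calc dist (f β) (f γ) ≤ dist (f β) (f α) + dist (f γ) (f α) := dist_triangle_right _ _ _
    _ < ε / 2 + ε / 2 := add_lt_add (key β hβ) (key γ hγ)
    _ = ε := by ring

/-- Perturbation of the generator of a positive contraction semigroup by a positive operator of
relative bound less than one with respect to `tr`. -/
theorem exists_perturbed_semigroup [CompleteSpace X] (hC : IsAdditiveNorm C tr)
    {S : ℝ → X →L[ℝ] X} (hS : IsPosSemigroup C S) {D : Submodule ℝ X} {H B : D →ₗ[ℝ] X}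
    (hH : GeneratedBy S (-H)) (hB : ∀ u : D, (u : X) ∈ C → B u ∈ C)
    (hBH : ∀ u : D, (u : X) ∈ C → tr (B u) ≤ tr (H u)) {a b : ℝ} (ha : 0 ≤ a) (hb0 : 0 ≤ b)
    (hb : b < 1) (hab : ∀ u : D, (u : X) ∈ C → tr (B u) ≤ a * tr u + b * tr (H u)) :
    ∃ T, IsPosSemigroup C T ∧ GeneratedBy T (-(H - B)) := by
  have hb1 : 0 < 1 - b := sub_pos.2 hb
  have hr₀ : 0 ≤ a / (1 - b) := by positivity
  have hD : Dense (D : Set X) := by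
    refine hS.dense_domain.mono ?_
    rintro u ⟨y, hy⟩
    obtain ⟨v, rfl, -⟩ := (hH u y).1 hy
    exact v.2
  have main : ∀ r, a / (1 - b) < r →
      (∀ f, ∃ u : D, r • (u : X) - (-(H - B)) u = f ∧ (f ∈ C → (u : X) ∈ C)) ∧
      ∀ u : D, r • (u : X) - (-(H - B)) u = 0 → u = 0 := by
    intro r hr
    have hr0 : 0 < r := hr₀.trans_lt hr
    obtain ⟨R, hR1, hR2, hR3, hR4⟩ := exists_resolvent_operator (C := C) (-H) hr0
      (fun u => IsSemigroup.norm_le_of_hasGen hS.norm_le_one (hH.hasGen u) r) (fun f => by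
        obtain ⟨u, hu, huC⟩ := hS.exists_resolvent hS.norm_le_one hS.mem hr0 f
        obtain ⟨v, rfl, hv⟩ := (hH _ _).1 hu
        exact ⟨v, by rw [hv]; abel, huC⟩)
    have hRD : ∀ f, R f ∈ D := fun f => by
      obtain ⟨u, hu, -⟩ := hR1 f
      rw [← hu]; exact u.2
    let Rd : X →ₗ[ℝ] D := R.toLinearMap.codRestrict D hRD
    have hRd : ∀ f, (Rd f : X) = R f := fun f => rfl
    have hRH : ∀ f, r • (Rd f : X) + H (Rd f) = f := fun f => by
      obtain ⟨u, hu, huf⟩ := hR1 f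
      have e : Rd f = u := Subtype.ext hu.symm
      rw [e]
      simpa using huf
    -- This is exactly where the threshold `a / (1 - b)` comes from.
    have hq : b + a / r < 1 := by
      rw [div_lt_iff₀ hb1] at hr
      rw [← lt_sub_iff_add_lt', div_lt_iff₀ hr0]
      linarith
    have hP0 : ∀ f ∈ C, ‖(B ∘ₗ Rd) f‖ ≤ (b + a / r) * ‖f‖ := by
      intro f hf
      have hu : (Rd f : X) ∈ C := hR4 f hf
      have h1 := hab (Rd f) hu
      -- For `u = R f` this gives `tr (H u) = ‖f‖ - r * tr u`, so the relative bound becomes a bound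
      -- by `‖f‖` alone.
      have h2 := congrArg tr (hRH f)
      rw [map_add, map_smul, smul_eq_mul] at h2
      have h3 : tr (Rd f) ≤ ‖f‖ / r := by
        rw [le_div_iff₀ hr0, mul_comm]
        rw [← hC.norm_eq _ hu, hRd]
        have := (r • R).le_of_opNorm_le hR3 f
        rwa [smul_apply, norm_smul, Real.norm_of_nonneg hr0.le, one_mul] at this
      have h4 := hC.tr_nonneg hu
      rw [LinearMap.comp_apply, hC.norm_eq _ (hB _ hu)]
      have h5 := hC.norm_eq f hf
      calc tr (B (Rd f)) ≤ a * tr (Rd f) + b * (‖f‖ - r * tr (Rd f)) := by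
            rw [h5, ← h2]; simpa using h1
        _ ≤ a * (‖f‖ / r) + b * ‖f‖ := by
            have h6 : 0 ≤ b * (r * tr (Rd f)) := by positivity
            have h7 := mul_le_mul_of_nonneg_left h3 ha
            linarith
        _ = (b + a / r) * ‖f‖ := by ring
    set P : X →L[ℝ] X := (B ∘ₗ Rd).mkContinuous (b + a / r) (hC.norm_le hP0) with hP
    have hPf : ∀ f, P f = B (Rd f) := fun f => rfl
    have hP1 : ‖P‖ < 1 :=
      (LinearMap.mkContinuous_norm_le _ (by positivity) _).trans_lt hq
    refine ⟨fun f => ?_, fun u hu => ?_⟩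
    -- The factorisation `(r + H - B) R g = g - B R g` reduces the equation to a Neumann series.
    · obtain ⟨g, hg, hgC⟩ := exists_sub_apply_eq hP1 (fun u hu => hB _ (hR4 u hu)) f
      refine ⟨Rd g, ?_, fun hf => hR4 g (hgC hf)⟩
      rw [← hg, hPf]
      rw [LinearMap.neg_apply, LinearMap.sub_apply, sub_neg_eq_add, ← add_sub_assoc, hRH]
    · have h1 := hR2 u
      have e : Rd (r • (u : X) - (-H) u) = u := Subtype.ext h1
      -- A kernel element `u` makes `(r + H) u` a fixed point of the strict contraction `P`.
      have h2 : P (r • (u : X) - (-H) u) = r • (u : X) - (-H) u := by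
        rw [hPf, e, ← sub_eq_zero, ← neg_eq_zero, ← hu]
        simp only [LinearMap.neg_apply, LinearMap.sub_apply]
        abel
      have h3 : ‖r • (u : X) - (-H) u‖ ≤ 0 := by
        have := P.le_opNorm (r • (u : X) - (-H) u)
        rw [h2] at this
        by_contra hn
        push Not at hn
        nlinarith
      rw [norm_le_zero_iff] at h3
      rw [← e, h3, map_zero]
  obtain ⟨T, hT, hT1, hTC, hgen⟩ := exists_semigroup_of_resolvent (C := C) (-(H - B)) hD hr₀
    (fun r hr u => by
      have hr0 : 0 < r := hr₀.trans_lt hr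
      -- On the cone, `tr f = r * tr v + tr (H v - B v) ≥ r * tr v`. For general `u` the right-hand
      -- side is split into positive parts, and injectivity identifies `u` with the difference of
      -- the two positive solutions.
      have hpos : ∀ v : D, (v : X) ∈ C → ∀ f ∈ C, r • (v : X) - (-(H - B)) v = f →
          r * ‖(v : X)‖ ≤ ‖f‖ := by
        intro v hv f hf hvf
        rw [hC.norm_eq f hf, hC.norm_eq v hv, ← hvf]
        have := hBH v hv
        simp only [map_sub, map_smul, LinearMap.neg_apply, LinearMap.sub_apply, map_neg, smul_eq_mul]
        linarith
      obtain ⟨f, hf, g, hg, hfg, hn⟩ := hC.decomp (r • (u : X) - (-(H - B)) u)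
      obtain ⟨v, hv, hvC⟩ := (main r hr).1 f
      obtain ⟨w, hw, hwC⟩ := (main r hr).1 g
      have e : u - (v - w) = 0 := by
        refine (main r hr).2 _ ?_
        rw [← hv, ← hw] at hfg
        rw [← sub_eq_zero] at hfg
        rw [← hfg]
        simp only [map_sub, LinearMap.neg_apply, LinearMap.sub_apply, Submodule.coe_sub, smul_sub]
        abel
      rw [hn, sub_eq_zero.1 e, Submodule.coe_sub]
      have h1 := hpos v (hvC hf) f hf hv
      have h2 := hpos w (hwC hg) g hg hw
      have h3 := mul_le_mul_of_nonneg_left (norm_sub_le (v : X) w) hr0.le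
      linarith)
    (fun r hr => (main r hr).1)
  exact ⟨T, ⟨hT, hT1, hTC⟩, hgen⟩

/-- The limit of an increasing net of positive contraction semigroups above a given one. -/
theorem exists_limit_of_monotone [CompleteSpace X] (hC : IsAdditiveNorm C tr)
    {S : ℝ → X →L[ℝ] X} (hS : IsPosSemigroup C S) {J : Type*} [Preorder J]
    [IsDirectedOrder J] [Nonempty J] {U : J → ℝ → X →L[ℝ] X} (hU : ∀ α, IsPosSemigroup C (U α))
    (hSU : ∀ α t, ∀ u ∈ C, U α t u - S t u ∈ C)
    (hmono : ∀ α β, α ≤ β → ∀ t, ∀ u ∈ C, U β t u - U α t u ∈ C) :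
    ∃ T, IsPosSemigroup C T ∧ (∀ t v, Tendsto (fun α => U α t v) atTop (𝓝 (T t v))) ∧
      ∀ (u y : X) (g : J → X), (∀ α, HasGen (U α) u (g α)) → Tendsto g atTop (𝓝 y) →
        HasGen T u y := by
  -- As `U α s h - S s h` is positive and `tr (U α s h) ≤ tr h`, its norm is at most `tr (h - S s
  -- h)`. Continuity at zero is thus uniform in `α`.
  have hle : ∀ α s, ∀ h ∈ C, ‖U α s h - h‖ ≤ 2 * ‖S s h - h‖ := by
    intro α s h hh
    have h1 : ‖U α s h - S s h‖ ≤ ‖h - S s h‖ := by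
      rw [hC.norm_eq _ (hSU α s h hh)]
      refine le_trans ?_ (hC.tr_le _)
      rw [map_sub, map_sub, ← hC.norm_eq _ ((hU α).mem s h hh), ← hC.norm_eq h hh]
      have := (U α s).le_of_opNorm_le ((hU α).norm_le_one s) h
      linarith
    have h2 := norm_add_le (U α s h - S s h) (S s h - h)
    rw [sub_add_sub_cancel] at h2
    rw [norm_sub_rev h] at h1
    linarith
  obtain ⟨T, hT, hT1, hTlim, hgen⟩ := exists_limit_semigroup (l := (atTop : Filter J)) (S := U)
    (fun α => (hU α).toIsSemigroup) (fun α => (hU α).norm_le_one)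
    (by
      intro v ε hε
      obtain ⟨a, ha, b, hb, rfl, -⟩ := hC.decomp v
      have hc : Continuous fun s => 2 * ‖S s a - a‖ + 2 * ‖S s b - b‖ := by
        have h1 := hS.cont a
        have h2 := hS.cont b
        fun_prop
      have h0 := hc.tendsto 0
      simp only [hS.zero_apply, sub_self, norm_zero, mul_zero, add_zero] at h0
      obtain ⟨δ, hδ, h⟩ := Metric.tendsto_nhds_nhds.1 h0 ε hε
      refine ⟨δ, hδ, fun α s hs hsδ => ?_⟩
      have h1 := h (x := s) (by rwa [Real.dist_0_eq_abs, abs_of_nonneg hs])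
      rw [Real.dist_0_eq_abs, abs_of_nonneg (by positivity)] at h1
      have e : U α s (a - b) - (a - b) = (U α s a - a) - (U α s b - b) := by rw [map_sub]; abel
      rw [e]
      refine (norm_sub_le _ _).trans ?_
      linarith [hle α s a ha, hle α s b hb])
    (by
      intro t v
      have hpos : ∀ a ∈ C, ∃ w, Tendsto (fun α => U α t a) atTop (𝓝 w) := fun a ha =>
        hC.exists_tendsto (M := ‖a‖) (fun α β h => hmono α β h t a ha) fun α => by
          rw [← hC.norm_eq _ ((hU α).mem t a ha)]
          simpa using (U α t).le_of_opNorm_le ((hU α).norm_le_one t) a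
      obtain ⟨a, ha, b, hb, rfl, -⟩ := hC.decomp v
      obtain ⟨x, hx⟩ := hpos a ha
      obtain ⟨y, hy⟩ := hpos b hb
      exact ⟨x - y, by simpa using hx.sub hy⟩)
  exact ⟨T, ⟨hT, hT1, fun t u hu => C.isClosed.mem_of_tendsto (hTlim t u)
    (Eventually.of_forall fun α => (hU α).mem t u hu)⟩, hTlim, hgen⟩

/-- The semigroup constructed from an increasing net of perturbations. -/
theorem exists_regularised_semigroup [CompleteSpace X] (hC : IsAdditiveNorm C tr)
    {S : ℝ → X →L[ℝ] X} (hS : IsPosSemigroup C S) {D : Submodule ℝ X} {H K : D →ₗ[ℝ] X}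
    (hH : GeneratedBy S (-H)) {J : Type*} [Preorder J] [IsDirectedOrder J] [Nonempty J]
    {B : J → D →ₗ[ℝ] X} (hB : ∀ α, ∀ u : D, (u : X) ∈ C → B α u ∈ C)
    (hBH : ∀ α, ∀ u : D, (u : X) ∈ C → tr (B α u) ≤ tr (H u))
    (hab : ∀ α, ∃ a b : ℝ, 0 ≤ a ∧ 0 ≤ b ∧ b < 1 ∧
      ∀ u : D, (u : X) ∈ C → tr (B α u) ≤ a * tr u + b * tr (H u))
    (hmono : ∀ α β, α ≤ β → ∀ u : D, (u : X) ∈ C → B β u - B α u ∈ C)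
    (hK : ∀ u : D, (u : X) ∈ C → Tendsto (fun α => B α u) atTop (𝓝 (K u))) :
    ∃ (T : ℝ → X →L[ℝ] X) (U : J → ℝ → X →L[ℝ] X), IsPosSemigroup C T ∧
      (∀ α, IsPosSemigroup C (U α) ∧ GeneratedBy (U α) (-(H - B α))) ∧
      (∀ t v, Tendsto (fun α => U α t v) atTop (𝓝 (T t v))) ∧
      ∀ u : D, (u : X) ∈ C → HasGen T u (K u - H u) := by
  have hex : ∀ α, ∃ T, IsPosSemigroup C T ∧ GeneratedBy T (-(H - B α)) := fun α => by
    obtain ⟨a, b, ha, hb0, hb, h⟩ := hab α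
    exact hC.exists_perturbed_semigroup hS hH (hB α) (hBH α) ha hb0 hb h
  choose U hU hUgen using hex
  obtain ⟨T, hT, hlim, hgen⟩ := hC.exists_limit_of_monotone hS hU
    (fun α t u hu => hS.sub_mem (hU α).toIsSemigroup hS.mem (hU α).mem (by
      intro v hv y hy
      obtain ⟨v, rfl, rfl⟩ := (hH _ _).1 hy
      refine ⟨_, (hUgen α).hasGen v, ?_⟩
      simpa using hB α v hv) hu t)
    (fun α β hαβ t u hu => (hU α).sub_mem (hU β).toIsSemigroup (hU α).mem (hU β).mem (by
      intro v hv y hy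
      obtain ⟨v, rfl, rfl⟩ := (hUgen α _ _).1 hy
      refine ⟨_, (hUgen β).hasGen v, ?_⟩
      simpa using hmono α β hαβ v hv) hu t)
  refine ⟨T, U, hT, fun α => ⟨hU α, hUgen α⟩, hlim, fun u hu => ?_⟩
  refine hgen u _ _ (fun α => (hUgen α).hasGen u) ?_
  simpa using (hK u hu).sub_const (H u)

/-- A semigroup whose generator extends `K - H` dominates the limit of semigroups generated by
smaller perturbations of `-H`. -/
lemma sub_mem_of_tendsto [CompleteSpace X] {D : Submodule ℝ X} {H K : D →ₗ[ℝ] X} {J : Type*}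
    {l : Filter J} [NeBot l] {B : J → D →ₗ[ℝ] X}
    (hBK : ∀ α, ∀ u : D, (u : X) ∈ C → K u - B α u ∈ C) {T V : ℝ → X →L[ℝ] X}
    {U : J → ℝ → X →L[ℝ] X} (hU : ∀ α, IsPosSemigroup C (U α))
    (hUgen : ∀ α, GeneratedBy (U α) (-(H - B α))) (hV : IsPosSemigroup C V)
    (hVgen : ∀ u : D, (u : X) ∈ C → HasGen V u (K u - H u))
    (hlim : ∀ t v, Tendsto (fun α => U α t v) l (𝓝 (T t v))) (t : ℝ) {u : X} (hu : u ∈ C) :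
    V t u - T t u ∈ C :=
  C.isClosed.mem_of_tendsto ((hlim t u).const_sub _) (Eventually.of_forall fun α =>
    (hU α).sub_mem hV.toIsSemigroup (hU α).mem hV.mem (by
      intro v hv y hy
      obtain ⟨v, rfl, rfl⟩ := (hUgen α _ _).1 hy
      refine ⟨_, hVgen v hv, ?_⟩
      simpa using hBK α v hv) hu t)

lemma eq_of_sub_mem (hC : IsAdditiveNorm C tr) {P Q : X →L[ℝ] X}
    (h : ∀ u ∈ C, P u - Q u ∈ C) (h' : ∀ u ∈ C, Q u - P u ∈ C) : P = Q := by
  have key : ∀ u ∈ C, P u = Q u := fun u hu =>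
    sub_eq_zero.1 (hC.eq_zero (h u hu) (by rw [neg_sub]; exact h' u hu))
  ext u
  obtain ⟨a, ha, b, hb, rfl, -⟩ := hC.decomp u
  rw [map_sub, map_sub, key a ha, key b hb]

end IsAdditiveNorm

end AdditiveNorm

/-! ### The trace class as a complete space with additive norm on the positive cone. -/

section TraceClass

variable {E : Type*} [NormedAddCommGroup E] [InnerProductSpace ℂ E] [CompleteSpace E]

/-- The trace of `a` is the squared Hilbert–Schmidt norm of its square root, which bounds the
squared operator norm by Parseval and Cauchy–Schwarz. -/
lemma norm_le_posTrace {a : E →L[ℂ] E} (ha : 0 ≤ a) (h : posTrace a ≠ ⊤) :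
    ‖a‖ ≤ (posTrace a).toReal := by
  set r := CFC.sqrt a with hr
  have hs : IsSelfAdjoint r := (CFC.sqrt_nonneg a).isSelfAdjoint
  have h1 : ∀ x, ‖r x‖ ^ 2 ≤ (posTrace a).toReal * ‖x‖ ^ 2 := by
    intro x
    rw [← ENNReal.ofReal_le_ofReal_iff (by positivity), ENNReal.ofReal_mul ENNReal.toReal_nonneg,
      ENNReal.ofReal_toReal h, parseval (stdBasis E), posTrace, ← ENNReal.tsum_mul_right]
    refine ENNReal.tsum_le_tsum fun i => ?_
    rw [inner_eq_norm_sqrt_sq ha, ← ENNReal.ofReal_mul (by positivity), ← mul_pow]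
    refine ENNReal.ofReal_le_ofReal ?_
    gcongr
    have e : ⟪stdBasis E i, r x⟫_ℂ = ⟪r (stdBasis E i), x⟫_ℂ := by
      rw [← ContinuousLinearMap.adjoint_inner_left, ← ContinuousLinearMap.star_eq_adjoint,
        hs.star_eq]
    rw [e]
    exact norm_inner_le_norm _ _
  have h2 : ‖r‖ ≤ √(posTrace a).toReal := by
    refine r.opNorm_le_bound (Real.sqrt_nonneg _) fun x => ?_
    rw [← abs_of_nonneg (norm_nonneg (r x)), ← abs_of_nonneg
      (mul_nonneg (Real.sqrt_nonneg _) (norm_nonneg x)), ← sq_le_sq, mul_pow,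
      Real.sq_sqrt ENNReal.toReal_nonneg]
    exact h1 x
  calc ‖a‖ = ‖r * r‖ := by rw [hr, CFC.sqrt_mul_sqrt_self a ha]
    _ ≤ ‖r‖ * ‖r‖ := norm_mul_le _ _
    _ ≤ √(posTrace a).toReal * √(posTrace a).toReal := by gcongr
    _ = (posTrace a).toReal := Real.mul_self_sqrt ENNReal.toReal_nonneg

lemma posTrace_posPart_lt_top (u : C1sa E) : posTrace u.toOp⁺ < ⊤ ∧ posTrace u.toOp⁻ < ⊤ := by
  have h := u.isTraceClass
  rwa [IsTraceClass, traceNorm_eq u.isSelfAdjoint, ENNReal.add_lt_top] at h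

/-- Makes the positive cone closed and lets quadratic forms identify trace-norm limits. -/
lemma C1sa.norm_toOp_le (u : C1sa E) : ‖u.toOp‖ ≤ ‖u‖ := by
  obtain ⟨h1, h2⟩ := posTrace_posPart_lt_top u
  rw [C1sa.norm_def, traceNorm_eq u.isSelfAdjoint, ENNReal.toReal_add h1.ne h2.ne]
  conv_lhs => rw [← CFC.posPart_sub_negPart u.toOp u.isSelfAdjoint]
  exact (norm_sub_le _ _).trans (add_le_add (norm_le_posTrace (CFC.posPart_nonneg _) h1.ne)
    (norm_le_posTrace (CFC.negPart_nonneg _) h2.ne))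

/-- The inclusion of the self-adjoint trace-class operators in the bounded operators. -/
noncomputable def C1sa.toOpL : C1sa E →L[ℝ] (E →L[ℂ] E) :=
  C1sa.toOp.mkContinuous 1 fun u => by rw [one_mul]; exact u.norm_toOp_le

lemma C1sa.continuous_toOp : Continuous (C1sa.toOp (E := E)) :=
  C1sa.toOpL.continuous

lemma traceNorm_of_nonneg {a : E →L[ℂ] E} (ha : 0 ≤ a) : traceNorm a = posTrace a := by
  rw [traceNorm, CFC.abs_of_nonneg a ha]

/-- A positive operator of finite trace as a trace-class operator. -/
def C1sa.ofNonneg (a : E →L[ℂ] E) (ha : 0 ≤ a) (h : posTrace a < ⊤) : C1sa E :=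
  ⟨a, ha.isSelfAdjoint, by rwa [IsTraceClass, traceNorm_of_nonneg ha]⟩

lemma C1sa.norm_ofNonneg (a : E →L[ℂ] E) (ha : 0 ≤ a) (h : posTrace a < ⊤) :
    ‖C1sa.ofNonneg a ha h‖ = (posTrace a).toReal := by
  rw [← traceNorm_of_nonneg ha]; rfl

lemma C1sa.isPos_iff {u : C1sa E} : u.IsPos ↔ 0 ≤ u.toOp :=
  (ContinuousLinearMap.nonneg_iff_isPositive _).symm

variable (E) in
/-- The cone of positive trace-class operators. -/
def posCone : ProperCone ℝ (C1sa E) where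
  carrier := {u | 0 ≤ u.toOp}
  zero_mem' := by simp
  add_mem' hu hv := by
    simp only [Set.mem_ofPred_eq, map_add] at *
    exact add_nonneg hu hv
  smul_mem' c u hu := by
    have e : C1sa.toOp (c • u) = (c : ℝ) • u.toOp := map_smul C1sa.toOp (c : ℝ) u
    simp only [Set.mem_ofPred_eq, e] at *
    exact smul_nonneg c.2 hu
  isClosed' := isClosed_Ici.preimage C1sa.continuous_toOp

lemma mem_posCone {u : C1sa E} : u ∈ posCone E ↔ u.IsPos :=
  C1sa.isPos_iff.symm

variable (E) in
/-- The trace as a linear functional. -/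
noncomputable def trLin : C1sa E →ₗ[ℝ] ℝ where
  toFun := C1sa.tr
  map_add' u v := by
    refine ((u + v).hasSum_tr (stdBasis E)).unique ?_
    simpa using (u.hasSum_tr (stdBasis E)).add (v.hasSum_tr (stdBasis E))
  map_smul' c u := by
    refine ((c • u).hasSum_tr (stdBasis E)).unique ?_
    have e : ∀ x, (⟪x, (c • u).toOp x⟫_ℂ).re = c * (⟪x, u.toOp x⟫_ℂ).re := fun x => by
      rw [map_smul, smul_apply, inner_smul_right_eq_smul]
      simp
    simpa only [e] using! (u.hasSum_tr (stdBasis E)).mul_left c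

lemma trLin_apply (u : C1sa E) : trLin E u = u.tr := rfl

lemma isAdditiveNorm_posCone : IsAdditiveNorm (posCone E) (trLin E) where
  norm_eq u hu := by
    have hu : 0 ≤ u.toOp := hu
    have h := u.isTraceClass
    rw [IsTraceClass, traceNorm_of_nonneg hu] at h
    rw [C1sa.norm_def, traceNorm_of_nonneg hu, trLin_apply]
    exact (hasSum_posTrace (stdBasis E) hu h.ne).unique (u.hasSum_tr (stdBasis E))
  decomp u := by
    obtain ⟨h1, h2⟩ := posTrace_posPart_lt_top u
    refine ⟨.ofNonneg u.toOp⁺ (CFC.posPart_nonneg _) h1, CFC.posPart_nonneg u.toOp,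
      .ofNonneg u.toOp⁻ (CFC.negPart_nonneg _) h2, CFC.negPart_nonneg u.toOp, ?_, ?_⟩
    · exact C1sa.toOp_injective (CFC.posPart_sub_negPart u.toOp u.isSelfAdjoint).symm
    · rw [C1sa.norm_ofNonneg, C1sa.norm_ofNonneg, C1sa.norm_def, traceNorm_eq u.isSelfAdjoint,
        ENNReal.toReal_add h1.ne h2.ne]

lemma summable_of_posTrace {a : ℕ → E →L[ℂ] E} (ha : ∀ n, 0 ≤ a n)
    (h : ∑' n, posTrace (a n) ≠ ⊤) : Summable a :=
  .of_norm_bounded (ENNReal.summable_toReal h) fun n =>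
    norm_le_posTrace (ha n) (ENNReal.ne_top_of_tsum_ne_top h n)

/-- Countable additivity of the trace on positive operators. -/
lemma posTrace_tsum {a : ℕ → E →L[ℂ] E} (ha : ∀ n, 0 ≤ a n) (hs : Summable a) :
    posTrace (∑' n, a n) = ∑' n, posTrace (a n) := by
  simp only [posTrace]
  rw [ENNReal.tsum_comm]
  refine tsum_congr fun i => ?_
  have h1 : HasSum (fun n => (⟪stdBasis E i, a n (stdBasis E i)⟫_ℂ).re)
      (⟪stdBasis E i, (∑' n, a n) (stdBasis E i)⟫_ℂ).re :=
    Complex.hasSum_re ((hs.hasSum.mapL (ContinuousLinearMap.apply ℂ E (stdBasis E i))).mapL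
      (innerSL ℂ (stdBasis E i)))
  rw [← h1.tsum_eq]
  exact ENNReal.ofReal_tsum_of_nonneg (fun n => re_inner_nonneg (ha n) _) h1.summable

lemma traceNorm_tsum_sub_tsum_le {a b : ℕ → E →L[ℂ] E} (ha : ∀ n, 0 ≤ a n) (hb : ∀ n, 0 ≤ b n)
    (has : Summable a) (hbs : Summable b) :
    traceNorm (∑' n, a n - ∑' n, b n) ≤ ∑' n, posTrace (a n) + ∑' n, posTrace (b n) := by
  rw [← posTrace_tsum ha has, ← posTrace_tsum hb hbs]
  exact traceNorm_sub_le (tsum_nonneg ha) (tsum_nonneg hb)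

lemma tsum_sub_tsum_sub_sum {G : Type*} [AddCommGroup G] [TopologicalSpace G]
    [IsTopologicalAddGroup G] [T2Space G] {a b : ℕ → G} (ha : Summable a) (hb : Summable b)
    (n : ℕ) : ∑' k, a k - ∑' k, b k - ∑ i ∈ Finset.range n, (a i - b i)
      = ∑' k, a (k + n) - ∑' k, b (k + n) := by
  rw [← ha.sum_add_tsum_nat_add n, ← hb.sum_add_tsum_nat_add n, Finset.sum_sub_distrib]
  abel

/-- For an absolutely convergent series, positive and negative parts are summed separately in
operator norm. Countable additivity of the trace makes both sums trace class and bounds the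
remainder by tails of convergent trace series. -/
instance : CompleteSpace (C1sa E) := by
  refine NormedAddCommGroup.completeSpace_of_summable_imp_tendsto fun u hu => ?_
  have hP0 : ∀ n, 0 ≤ (u n).toOp⁺ := fun n => CFC.posPart_nonneg _
  have hN0 : ∀ n, 0 ≤ (u n).toOp⁻ := fun n => CFC.negPart_nonneg _
  have hsum : ∑' n, traceNorm (u n).toOp ≠ ⊤ := by
    have e : ∀ n, traceNorm (u n).toOp = ENNReal.ofReal ‖u n‖ := fun n => by
      rw [C1sa.norm_def, ENNReal.ofReal_toReal (u n).isTraceClass.ne]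
    simp only [e]
    exact hu.tsum_ofReal_ne_top
  have hPN : ∑' n, posTrace (u n).toOp⁺ + ∑' n, posTrace (u n).toOp⁻ ≠ ⊤ := by
    rw [← ENNReal.tsum_add]
    simpa only [traceNorm_eq (C1sa.isSelfAdjoint _)] using hsum
  obtain ⟨hPt, hNt⟩ := ENNReal.add_ne_top.1 hPN
  have hPs := summable_of_posTrace hP0 hPt
  have hNs := summable_of_posTrace hN0 hNt
  have hex : ∀ a : ℕ → E →L[ℂ] E, (∀ n, 0 ≤ a n) → ∑' n, posTrace (a n) ≠ ⊤ →
      ∃ w : C1sa E, w.toOp = ∑' n, a n := fun a ha h =>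
    ⟨C1sa.ofNonneg (∑' n, a n) (tsum_nonneg ha)
      (by rw [posTrace_tsum ha (summable_of_posTrace ha h)]; exact h.lt_top), rfl⟩
  obtain ⟨P, hP⟩ := hex _ hP0 hPt
  obtain ⟨N, hN⟩ := hex _ hN0 hNt
  refine ⟨P - N, ?_⟩
  rw [tendsto_iff_norm_sub_tendsto_zero]
  have hlim : Tendsto (fun n => (∑' k, posTrace (u (k + n)).toOp⁺
      + ∑' k, posTrace (u (k + n)).toOp⁻).toReal) atTop (𝓝 0) := by
    have h := (ENNReal.tendsto_sum_nat_add _ hPt).add (ENNReal.tendsto_sum_nat_add _ hNt)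
    rw [add_zero] at h
    have h2 := (ENNReal.tendsto_toReal ENNReal.zero_ne_top).comp h
    rwa [ENNReal.toReal_zero] at h2
  refine squeeze_zero' (Eventually.of_forall fun _ => norm_nonneg _) ?_ hlim
  have hev : ∀ᶠ n in atTop, (∑' k, posTrace (u (k + n)).toOp⁺
      + ∑' k, posTrace (u (k + n)).toOp⁻) ≠ ⊤ := by
    refine Eventually.of_forall fun n => ENNReal.add_ne_top.2 ⟨?_, ?_⟩
    · exact ne_top_of_le_ne_top hPt (ENNReal.tsum_comp_le_tsum_of_injective
        (add_left_injective n) fun k => posTrace (u k).toOp⁺)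
    · exact ne_top_of_le_ne_top hNt (ENNReal.tsum_comp_le_tsum_of_injective
        (add_left_injective n) fun k => posTrace (u k).toOp⁻)
  filter_upwards [hev] with n hn
  rw [norm_sub_rev, C1sa.norm_def]
  refine ENNReal.toReal_mono hn ?_
  have e : C1sa.toOp (P - N - ∑ i ∈ Finset.range n, u i)
      = ∑' k, (u (k + n)).toOp⁺ - ∑' k, (u (k + n)).toOp⁻ := by
    rw [map_sub, map_sub, map_sum, hP, hN]
    rw [← tsum_sub_tsum_sub_sum hPs hNs]
    congr 1
    exact Finset.sum_congr rfl fun i _ =>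
      (CFC.posPart_sub_negPart (u i).toOp (u i).isSelfAdjoint).symm
  rw [e]
  have hPs' := hPs.comp_injective (add_left_injective n)
  have hNs' := hNs.comp_injective (add_left_injective n)
  exact traceNorm_tsum_sub_tsum_le (fun k => hP0 (k + n)) (fun k => hN0 (k + n)) hPs' hNs'

/-- An increasing net below `g` that converges to `g` as quadratic forms on a dense subspace
converges in trace norm. -/
lemma tendsto_of_tendsto_inner {J : Type*} [Preorder J] [IsDirectedOrder J] [Nonempty J]
    {f : J → C1sa E} {g : C1sa E} (hf : ∀ α β, α ≤ β → f β - f α ∈ posCone E)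
    (hg : ∀ α, g - f α ∈ posCone E) {V : Submodule ℂ E} (hV : Dense (V : Set E))
    (h : ∀ x ∈ V, Tendsto (fun α => ⟪(f α).toOp x, x⟫_ℂ) atTop (𝓝 ⟪g.toOp x, x⟫_ℂ)) :
    Tendsto f atTop (𝓝 g) := by
  -- Monotonicity and the bound by `Tr g` already force trace-norm convergence; the forms on `V`
  -- only identify the limit, by density and polarisation.
  obtain ⟨y, hy⟩ := isAdditiveNorm_posCone.exists_tendsto hf (M := trLin E g) fun α => by
    have := isAdditiveNorm_posCone.tr_nonneg (hg α)
    rw [map_sub] at this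
    linarith
  have hy' : ∀ x, Tendsto (fun α => ⟪(f α).toOp x, x⟫_ℂ) atTop (𝓝 ⟪y.toOp x, x⟫_ℂ) := fun x => by
    have hc : Continuous fun w : C1sa E => w.toOp x :=
      C1sa.continuous_toOp.clm_apply continuous_const
    have h1 := (hc.tendsto y).comp hy
    exact h1.inner tendsto_const_nhds
  have e : (fun x => ⟪y.toOp x, x⟫_ℂ) = fun x => ⟪g.toOp x, x⟫_ℂ :=
    Continuous.ext_on hV (by fun_prop) (by fun_prop) fun x hx =>
      tendsto_nhds_unique (hy' x) (h x hx)
  have e2 : y.toOp = g.toOp := ContinuousLinearMap.coe_injective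
    ((ext_inner_map y.toOp.toLinearMap g.toOp.toLinearMap).1 fun x => congrFun e x)
  rwa [← C1sa.toOp_injective e2]

end TraceClass

/-! ### Functional regularisations and the minimality of their semigroups. -/

section Regularisation

variable {E : Type*} [NormedAddCommGroup E] [InnerProductSpace ℂ E] [CompleteSpace E]

lemma isGenerator_iff {X : Type*} [NormedAddCommGroup X] [NormedSpace ℝ X] {D : Submodule ℝ X}
    {A : D →ₗ[ℝ] X} {T : ℝ → X →L[ℝ] X} :
    IsGenerator (-(⟨D, A⟩ : X →ₗ.[ℝ] X)) T ↔ GeneratedBy T (-A) := by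
  refine forall₂_congr fun u y => ?_
  rw [LinearPMap.mem_graph_iff]
  exact ⟨fun h => h.symm, fun h => h.symm⟩

lemma IsDynamicalSemigroup.isPosSemigroup {S : ℝ → C1sa E →L[ℝ] C1sa E}
    (hS : IsDynamicalSemigroup S) : IsPosSemigroup (posCone E) (extendOne S) where
  toIsSemigroup := hS.isC0Semigroup.isSemigroup_extendOne
  norm_le_one t := by
    rw [extendOne]
    split_ifs with h
    exacts [hS.norm_le_one t h, ContinuousLinearMap.norm_id_le]
  mem t u hu := by
    rw [extendOne]
    split_ifs with h
    exacts [mem_posCone.2 (hS.pos t h u (mem_posCone.1 hu)), hu]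

lemma IsPosSemigroup.isDynamicalSemigroup {T : ℝ → C1sa E →L[ℝ] C1sa E}
    (hT : IsPosSemigroup (posCone E) T) : IsDynamicalSemigroup T where
  isC0Semigroup := hT.isC0Semigroup
  norm_le_one t _ := hT.norm_le_one t
  pos t _ u hu := mem_posCone.1 (hT.mem t u (mem_posCone.2 hu))

lemma IsSemigroup.eq_of_generatedBy {X : Type*} [NormedAddCommGroup X] [NormedSpace ℝ X]
    [CompleteSpace X] {D : Submodule ℝ X} {A : D →ₗ[ℝ] X} {U V : ℝ → X →L[ℝ] X}
    (hU : IsSemigroup U) (hUA : GeneratedBy U A) (hV : IsC0Semigroup V) (hVA : GeneratedBy V A)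
    {t : ℝ} (ht : 0 < t) : V t = U t := by
  rw [hU.eq_of_hasGen hV.isSemigroup_extendOne fun u y h =>
    hasGen_extendOne.2 ((hVA u y).2 ((hUA u y).1 h)), extendOne_of_pos V ht]

/-- The semigroup of a functional regularisation exists, its generator extends `K - H`, and it is
below every semigroup with these properties. -/
theorem IsFunctionalRegularisation.exists_semigroup {H : C1sa E →ₗ.[ℝ] C1sa E}
    (hH : ∃ S : ℝ → C1sa E →L[ℝ] C1sa E, IsDynamicalSemigroup S ∧ IsGenerator (-H) S)
    {K : H.domain →ₗ[ℝ] C1sa E}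
    (hKH : ∀ u : H.domain, (u : C1sa E).IsPos → (K u).tr ≤ (H u).tr)
    {J : Type*} [Preorder J] [IsDirectedOrder J] [Nonempty J] {B : J → H.domain →ₗ[ℝ] C1sa E}
    (hB : IsFunctionalRegularisation H K B) :
    ∃ T, IsPosSemigroup (posCone E) T ∧ IsRegularisedSemigroup H B T ∧
      (∀ T', IsRegularisedSemigroup H B T' → ∀ t, 0 < t → T' t = T t) ∧
      (∀ u : H.domain, (u : C1sa E) ∈ posCone E → HasGen T u (K u - H u)) ∧
      ∀ V, IsPosSemigroup (posCone E) V →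
        (∀ u : H.domain, (u : C1sa E) ∈ posCone E → HasGen V u (K u - H u)) →
        ∀ t, ∀ u ∈ posCone E, V t u - T t u ∈ posCone E := by
  obtain ⟨S, hS, hSH⟩ := hH
  have hSH' : GeneratedBy (extendOne S) (-H.toFun) := fun u y => by
    rw [hasGen_extendOne]
    exact isGenerator_iff.1 hSH u y
  have hBK : ∀ α, ∀ u : H.domain, (u : C1sa E) ∈ posCone E → K u - B α u ∈ posCone E :=
    fun α u hu => mem_posCone.2 (hB.le α u (mem_posCone.1 hu))
  have hmono : ∀ α β, α ≤ β → ∀ u : H.domain, (u : C1sa E) ∈ posCone E →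
      B β u - B α u ∈ posCone E :=
    fun α β h u hu => mem_posCone.2 (hB.mono α β h u (mem_posCone.1 hu))
  obtain ⟨T, U, hT, hU, hlim, hgen⟩ :=
    isAdditiveNorm_posCone.exists_regularised_semigroup (K := K) hS.isPosSemigroup hSH'
      (B := B) (fun α u hu => mem_posCone.2 (hB.posPreserving α u (mem_posCone.1 hu)))
      (fun α u hu => by
        have h1 := isAdditiveNorm_posCone.tr_nonneg (hBK α u hu)
        have h2 := hKH u (mem_posCone.1 hu)
        rw [map_sub] at h1
        exact (sub_nonneg.1 h1).trans h2)
      (fun α => by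
        obtain ⟨a, b, ha, hb0, hb1, h⟩ := hB.trace_le α
        exact ⟨a, b, ha, hb0, hb1, fun u hu => h u (mem_posCone.1 hu)⟩)
      hmono
      (fun u hu => by
        obtain ⟨V, hV, h⟩ := hB.tendsto u (mem_posCone.1 hu)
        exact tendsto_of_tendsto_inner (fun α β hαβ => hmono α β hαβ u hu)
          (fun α => hBK α u hu) hV h)
  refine ⟨T, hT, ⟨U, fun α => ⟨(hU α).1.isC0Semigroup, isGenerator_iff.2 (hU α).2⟩,
    fun t _ u => hlim t u⟩, ?_, hgen, fun V hV hVgen t u hu => ?_⟩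
  -- The semigroups `U'` are not assumed contractive, but share their generators with `U`, so both
  -- nets agree at positive times.
  · rintro T' ⟨U', hU', hlim'⟩ t ht
    ext1 u
    refine tendsto_nhds_unique (hlim' t ht u) ((hlim t u).congr fun α => ?_)
    rw [(hU α).1.toIsSemigroup.eq_of_generatedBy (hU α).2 (hU' α).1
      (isGenerator_iff.1 (hU' α).2) ht]
  · exact IsAdditiveNorm.sub_mem_of_tendsto hBK (fun α => (hU α).1) (fun α => (hU α).2) hV hVgen
      hlim t hu

end Regularisation

end KatoReg

theorem corollary2p9 {E : Type*} [NormedAddCommGroup E] [InnerProductSpace ℂ E] [CompleteSpace E]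
    (H : KatoReg.C1sa E →ₗ.[ℝ] KatoReg.C1sa E)
    (hH : ∃ S : ℝ → KatoReg.C1sa E →L[ℝ] KatoReg.C1sa E,
      KatoReg.IsDynamicalSemigroup S ∧ KatoReg.IsGenerator (-H) S)
    (K : H.domain →ₗ[ℝ] KatoReg.C1sa E)
    (hK : KatoReg.PosPreserving K)
    (hKH : ∀ u : H.domain, (u : KatoReg.C1sa E).IsPos → (K u).tr ≤ (H u).tr)
    {J : Type*} [Preorder J] [IsDirectedOrder J] [Nonempty J]
    (Kα : J → H.domain →ₗ[ℝ] KatoReg.C1sa E)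
    (hKα : KatoReg.IsFunctionalRegularisation H K Kα)
    {J' : Type*} [Preorder J'] [IsDirectedOrder J'] [Nonempty J']
    (Kα' : J' → H.domain →ₗ[ℝ] KatoReg.C1sa E)
    (hKα' : KatoReg.IsFunctionalRegularisation H K Kα') :
    (∃ T : ℝ → KatoReg.C1sa E →L[ℝ] KatoReg.C1sa E,
      KatoReg.IsDynamicalSemigroup T ∧ KatoReg.IsRegularisedSemigroup H Kα T) ∧
    (∃ T' : ℝ → KatoReg.C1sa E →L[ℝ] KatoReg.C1sa E,
      KatoReg.IsDynamicalSemigroup T' ∧ KatoReg.IsRegularisedSemigroup H Kα' T') ∧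
    ∀ T T' : ℝ → KatoReg.C1sa E →L[ℝ] KatoReg.C1sa E,
      KatoReg.IsRegularisedSemigroup H Kα T → KatoReg.IsRegularisedSemigroup H Kα' T' →
      ∀ t : ℝ, 0 < t → T t = T' t := by

  obtain ⟨T, hT, hreg, huniq, hgen, hmin⟩ := hKα.exists_semigroup hH hKH
  obtain ⟨T', hT', hreg', huniq', hgen', hmin'⟩ := hKα'.exists_semigroup hH hKH
  refine ⟨⟨T, hT.isDynamicalSemigroup, hreg⟩, ⟨T', hT'.isDynamicalSemigroup, hreg'⟩,
    fun V V' hV hV' t ht => ?_⟩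
  rw [huniq V hV t ht, huniq' V' hV' t ht]
  -- Each semigroup is a competitor in the minimality property of the other.
  exact KatoReg.isAdditiveNorm_posCone.eq_of_sub_mem (hmin' T hT hgen t) (hmin T' hT' hgen' t)
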